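/- Let $N\ge 0$ and $n\ge 2$ be integers, $V=\mathbb C^N$ with its standard scalar product, and let $V^{\otimes n}$ carry the induced scalar product, the product representation of $\mathrm{SU}(N)$, and the representation of the symmetric group $S_n$ (extended to $\mathbb C[S_n]$) that permutes the tensor factors. For a standard Young tableau $\Theta$ with $m$ boxes, let $s_\Theta=\sum_h h$ be the sum over all $h\in S_m$ that preserve each row of $\Theta$, let $a_\Theta=\sum_v \mathrm{sign}(v)\,v$ be the signed sum over all $v\in S_m$ that preserve each column of $\Theta$, let $|\Theta|$ be the product of the hook lengths of the boxes of $\Theta$, and let $Y_\Theta=\frac1{|\Theta|}s_\Theta a_\Theta$ be the Young operator, regarded as an operator on $V^{\otimes m}$. Define operators $P_\Theta$ on $V^{\otimes m}$ recursively by $P_\Theta=Y_\Theta$ if $m=2$, and, for $m\ge3$, $$P_\Theta=(P_{\Theta'}\otimes 1)\,Y_\Theta\,(P_{\Theta'}\otimes 1),$$ where $\Theta'$ is the standard tableau obtained from $\Theta$ by removing the box that holds $m$. Then, for all standard tableaux $\Theta,\Phi$ with $n$ boxes: (i) $P_\Theta P_\Phi=\delta_{\Theta\Phi}P_\Theta$;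 (ii) $\operatorname{tr}P_\Theta=\operatorname{tr}Y_\Theta$; (iii) $\sum_{\Theta}P_\Theta=1$ on $V^{\otimes n}$, the sum running over all standard tableaux with $n$ boxes; (iv) $P_\Theta^\dagger=P_\Theta$. Hence $P_\Theta$ is the orthogonal projector onto an $\mathrm{SU}(N)$-invariant subspace of $V^{\otimes n}$. This subspace is irreducible if $\Theta$ has at most $N$ rows, and it is $0$ if $\Theta$ has more than $N$ rows. -/

import Mathlib

open scoped TensorProduct

noncomputable section

namespace HermitianYoung

/-- Standard Young tableaux with `n` boxes. The entries are `0, …, n - 1` (`k` stands for the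
number `k + 1`), and `pos k` is the box, as a pair (row, column), that holds `k`. -/
structure StandardTableau (n : ℕ) where
  /-- the underlying Young diagram -/
  shape : YoungDiagram
  /-- the box that holds a given number -/
  pos : Fin n → ℕ × ℕ
  pos_injective : Function.Injective pos
  mem_shape_iff : ∀ c : ℕ × ℕ, c ∈ shape ↔ ∃ k, pos k = c
  /-- entries increase from left to right within each row -/
  row_increasing : ∀ k l, (pos k).1 = (pos l).1 → (pos k).2 < (pos l).2 → k < l
  /-- entries increase from top to bottom within each column -/
  col_increasing : ∀ k l, (pos k).2 = (pos l).2 → (pos k).1 < (pos l).1 → k < l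

namespace StandardTableau

theorem ext_pos {n : ℕ} {Θ Φ : StandardTableau n} (h : Θ.pos = Φ.pos) : Θ = Φ := by
  have hs : Θ.shape = Φ.shape := by
    ext c
    simp only [YoungDiagram.mem_cells]
    rw [Θ.mem_shape_iff, Φ.mem_shape_iff, h]
  cases Θ
  cases Φ
  simp only at h hs
  subst h hs
  rfl

theorem card_shape {n : ℕ} (Θ : StandardTableau n) : Θ.shape.card = n := by
  have h : Θ.shape.cells = Finset.univ.image Θ.pos := by
    ext c
    simp [Θ.mem_shape_iff c]
  rw [YoungDiagram.card, h, Finset.card_image_of_injective _ Θ.pos_injective, Finset.card_univ,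
    Fintype.card_fin]

theorem pos_lt {n : ℕ} (Θ : StandardTableau n) (k : Fin n) :
    (Θ.pos k).1 < n ∧ (Θ.pos k).2 < n := by
  have hk : ((Θ.pos k).1, (Θ.pos k).2) ∈ Θ.shape := (Θ.mem_shape_iff _).2 ⟨k, rfl⟩
  have hc := Θ.card_shape
  rw [YoungDiagram.card] at hc
  constructor
  · refine lt_of_lt_of_le (YoungDiagram.mem_iff_lt_colLen.1 hk) ?_
    rw [YoungDiagram.colLen_eq_card]
    exact (Finset.card_le_card (Finset.filter_subset _ _)).trans hc.le
  · refine lt_of_lt_of_le (YoungDiagram.mem_iff_lt_rowLen.1 hk) ?_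
    rw [YoungDiagram.rowLen_eq_card]
    exact (Finset.card_le_card (Finset.filter_subset _ _)).trans hc.le

instance finite (n : ℕ) : Finite (StandardTableau n) := by
  let f : StandardTableau n → (Fin n → Fin n × Fin n) :=
    fun Θ k => (⟨(Θ.pos k).1, (Θ.pos_lt k).1⟩, ⟨(Θ.pos k).2, (Θ.pos_lt k).2⟩)
  refine Finite.of_injective f fun Θ Φ h => ext_pos ?_
  funext k
  have hk := congrFun h k
  simp only [f, Prod.mk.injEq, Fin.mk.injEq] at hk
  exact Prod.ext hk.1 hk.2

instance fintype (n : ℕ) : Fintype (StandardTableau n) := Fintype.ofFinite _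

instance decEq (n : ℕ) : DecidableEq (StandardTableau n) := Classical.decEq _

theorem isLowerSet_erase {n : ℕ} (Θ : StandardTableau (n + 1)) :
    IsLowerSet (Θ.shape.cells.erase (Θ.pos (Fin.last n)) : Set (ℕ × ℕ)) := by
  intro d c hcd hd
  simp only [Finset.coe_erase, Set.mem_sdiff, Finset.mem_coe, YoungDiagram.mem_cells,
    Set.mem_singleton_iff] at hd ⊢
  obtain ⟨hd, hne⟩ := hd
  refine ⟨Θ.shape.up_left_mem hcd.1 hcd.2 hd, ?_⟩
  rintro rfl
  obtain ⟨l, hl⟩ := (Θ.mem_shape_iff _).1 hd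
  obtain ⟨m, hm⟩ := (Θ.mem_shape_iff _).1
    (Θ.shape.up_left_mem hcd.1 (le_refl d.2) hd)
  rcases lt_or_eq_of_le hcd.2 with h2 | h2
  · refine absurd (Θ.row_increasing (Fin.last n) m ?_ ?_) (not_lt.2 (Fin.le_last m))
    · rw [hm]
    · rw [hm]; exact h2
  · rcases lt_or_eq_of_le hcd.1 with h1 | h1
    · refine absurd (Θ.col_increasing (Fin.last n) l ?_ ?_) (not_lt.2 (Fin.le_last l))
      · rw [hl]; exact h2
      · rw [hl]; exact h1
    · exact hne (Prod.ext h1.symm h2.symm)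

/-- The tableau `Θ'` obtained from `Θ` by removing the box with the highest number. -/
def removeLast {n : ℕ} (Θ : StandardTableau (n + 1)) : StandardTableau n where
  shape := ⟨Θ.shape.cells.erase (Θ.pos (Fin.last n)), Θ.isLowerSet_erase⟩
  pos k := Θ.pos k.castSucc
  pos_injective := Θ.pos_injective.comp (Fin.castSucc_injective n)
  mem_shape_iff c := by
    rw [YoungDiagram.mem_mk, Finset.mem_erase, YoungDiagram.mem_cells, Θ.mem_shape_iff]
    constructor
    · rintro ⟨hne, k, rfl⟩
      induction k using Fin.lastCases with
      | last => exact absurd rfl hne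
      | cast k => exact ⟨k, rfl⟩
    · rintro ⟨k, rfl⟩
      exact ⟨fun h => (Fin.castSucc_lt_last k).ne (Θ.pos_injective h), _, rfl⟩
  row_increasing k l h1 h2 := Fin.castSucc_lt_castSucc_iff.1 (Θ.row_increasing _ _ h1 h2)
  col_increasing k l h1 h2 := Fin.castSucc_lt_castSucc_iff.1 (Θ.col_increasing _ _ h1 h2)

/-- The number of rows of a tableau, i.e. the length of its first column. -/
def numRows {n : ℕ} (Θ : StandardTableau n) : ℕ := Θ.shape.colLen 0

/-- The product of the hook lengths of the boxes. For a box `c` of the diagram the two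
subtractions are the numbers of boxes to the right of `c` and below `c`. -/
def hookProduct {n : ℕ} (Θ : StandardTableau n) : ℕ :=
  ∏ c ∈ Θ.shape.cells,
    ((Θ.shape.rowLen c.1 - (c.2 + 1)) + (Θ.shape.colLen c.2 - (c.1 + 1)) + 1)

/-- The horizontal permutations: those that preserve every row of the tableau. -/
def rowPerms {n : ℕ} (Θ : StandardTableau n) : Finset (Equiv.Perm (Fin n)) :=
  Finset.univ.filter fun σ => ∀ k, (Θ.pos (σ k)).1 = (Θ.pos k).1

/-- The vertical permutations: those that preserve every column of the tableau. -/
def colPerms {n : ℕ} (Θ : StandardTableau n) : Finset (Equiv.Perm (Fin n)) :=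
  Finset.univ.filter fun σ => ∀ k, (Θ.pos (σ k)).2 = (Θ.pos k).2

/-- The row symmetrizer in the group algebra of `S_n`. -/
def rowSymmetrizer {n : ℕ} (Θ : StandardTableau n) : MonoidAlgebra ℂ (Equiv.Perm (Fin n)) :=
  ∑ σ ∈ Θ.rowPerms, MonoidAlgebra.single σ 1

/-- The column antisymmetrizer in the group algebra of `S_n`. -/
def colAntisymmetrizer {n : ℕ} (Θ : StandardTableau n) :
    MonoidAlgebra ℂ (Equiv.Perm (Fin n)) :=
  ∑ σ ∈ Θ.colPerms, MonoidAlgebra.single σ ((Equiv.Perm.sign σ : ℤ) : ℂ)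

/-- The Young operator of a standard tableau, in the group algebra of `S_n`. -/
def young {n : ℕ} (Θ : StandardTableau n) : MonoidAlgebra ℂ (Equiv.Perm (Fin n)) :=
  ((Θ.hookProduct : ℂ)⁻¹) • (Θ.rowSymmetrizer * Θ.colAntisymmetrizer)

end StandardTableau

/-- `V = ℂ^N` with its standard scalar product. -/
abbrev V (N : ℕ) : Type := EuclideanSpace ℂ (Fin N)

/-- The tensor power `V^{⊗ n}`. -/
abbrev VPow (N n : ℕ) : Type := ⨂[ℂ]^n (V N)

/-- The representation of `S_n` on `V^{⊗ n}` by permutation of the factors: the `i`-th factor is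
moved to position `σ i`. -/
def permRep (N n : ℕ) : Representation ℂ (Equiv.Perm (Fin n)) (VPow N n) where
  toFun σ := (PiTensorProduct.reindex ℂ (fun _ => V N) σ).toLinearMap
  map_one' := by
    refine PiTensorProduct.ext (MultilinearMap.ext fun v => ?_)
    simp
    rfl
  map_mul' σ τ := by
    refine PiTensorProduct.ext (MultilinearMap.ext fun v => ?_)
    simp
    rfl

/-- The product representation of `SU(N)` on `V^{⊗ n}`, `g ↦ g ⊗ ⋯ ⊗ g`. -/
def suRep (N n : ℕ) :
    Representation ℂ (Matrix.specialUnitaryGroup (Fin N) ℂ) (VPow N n) where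
  toFun g := PiTensorProduct.map fun _ : Fin n => Matrix.toEuclideanLin g.1
  map_one' := by
    refine PiTensorProduct.ext (MultilinearMap.ext fun v => ?_)
    simp
  map_mul' g h := by
    refine PiTensorProduct.ext (MultilinearMap.ext fun v => ?_)
    simp [Matrix.toLpLin_apply]

/-- The basis `e_{a_1} ⊗ ⋯ ⊗ e_{a_n}` of `V^{⊗ n}`. -/
def stdBasis (N n : ℕ) : Module.Basis (Fin n → Fin N) ℂ (VPow N n) :=
  Basis.piTensorProduct fun _ => (EuclideanSpace.basisFun (Fin N) ℂ).toBasis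

/-- The scalar product on `V^{⊗ n}` induced by that of `V`, antilinear in the first argument; see
`tensorInner_tprod`. -/
def tensorInner {N n : ℕ} (x y : VPow N n) : ℂ :=
  ∑ a, star ((stdBasis N n).repr x a) * (stdBasis N n).repr y a

theorem tensorInner_tprod {N n : ℕ} (v w : Fin n → V N) :
    tensorInner (PiTensorProduct.tprod ℂ v) (PiTensorProduct.tprod ℂ w) =
      ∏ i, inner ℂ (v i) (w i) := by
  have h : ∀ i, inner ℂ (v i) (w i) = ∑ j, star (v i j) * w i j := by
    intro i
    simp [PiLp.inner_apply, mul_comm]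
  simp only [h, Finset.prod_univ_sum, Fintype.piFinset_univ, Finset.prod_mul_distrib]
  simp [tensorInner, stdBasis, star_prod]

/-- `A` is Hermitian with respect to the scalar product of `V^{⊗ n}`. -/
def IsHermitianOp {N n : ℕ} (A : Module.End ℂ (VPow N n)) : Prop :=
  ∀ x y, tensorInner (A x) y = tensorInner x (A y)

/-- `A` is the orthogonal projector of `V^{⊗ n}` onto the subspace `U`. -/
def IsOrthogonalProjectorOnto {N n : ℕ} (A : Module.End ℂ (VPow N n))
    (U : Submodule ℂ (VPow N n)) : Prop :=
  ∀ x, A x ∈ U ∧ ∀ u ∈ U, tensorInner u (x - A x) = 0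

/-- `A ⊗ 1` on `V^{⊗ (n + 1)} = V^{⊗ n} ⊗ V`. -/
def tensorOne {N n : ℕ} (A : Module.End ℂ (VPow N n)) : Module.End ℂ (VPow N (n + 1)) :=
  (TensorPower.mulEquiv (R := ℂ) (M := V N) (n := n) (m := 1)).conj
    (TensorProduct.map A LinearMap.id)

/-- The Young operator acting on `V^{⊗ n}`. -/
def Y (N : ℕ) {n : ℕ} (Θ : StandardTableau n) : Module.End ℂ (VPow N n) :=
  (permRep N n).asAlgebraHom Θ.young

/-- The operators `P_Θ`: the Young operators for at most two boxes, and
`P_Θ = (P_{Θ'} ⊗ 1) Y_Θ (P_{Θ'} ⊗ 1)` from three boxes on. -/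
def P (N : ℕ) : {n : ℕ} → StandardTableau n → Module.End ℂ (VPow N n)
  | 0, Θ => Y N Θ
  | 1, Θ => Y N Θ
  | 2, Θ => Y N Θ
  | _ + 3, Θ => tensorOne (P N Θ.removeLast) * Y N Θ * tensorOne (P N Θ.removeLast)

end HermitianYoung

end

noncomputable section

namespace HermitianYoung

/-! ### Traces, idempotents and the adjoint in the group algebra -/

section GroupAlgebra

open MonoidAlgebra

/-! All the operators come from `ℂ[S_n]`. There `proj Θ = q Y q`, where `q` is the element of the
parent tableau `Θ'`, embedded through `S_n ⊂ S_{n+1}`, and starting the recursion at `1` for the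
empty tableau gives the same operators. Four properties are carried through the induction
(`ProjProperties`): orthogonality, completeness, self-adjointness, and the sandwich identity `a p s
= a s`, with `s`, `a` the row symmetrizer and column antisymmetrizer.

Since `a` and `s` absorb the antisymmetrizer and symmetrizer of the parent, the sandwich identity
passes to `a q s = a s`, whence `Y q Y = Y Y = Y` and `q Y q` is idempotent. For two different
tableaux either the parents differ, and the two `q` annihilate each other, or the parents agree, the
shapes differ, and `Y_Θ x Y_Φ = 0` for every `x` by von Neumann's argument.

Left multiplication by an idempotent has trace `n!` times its coefficient at the neutral element,
and this trace is its rank. The coefficient of `q Y q` is `1/|Θ|`, and these numbers sum to `1`; so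
`1 - ∑ p` is an idempotent of rank zero and vanishes. The arguments for orthogonality also give
`p_Φ† p_Θ = 0` for `Φ ≠ Θ`; multiplying `∑ p_Φ† = 1` by `p_Θ` leaves `p_Θ = p_Θ† p_Θ`, which is
self-adjoint.

That the hook product is the right normalization is proved in the same induction. The symmetrizer is
idempotent up to a nonzero constant `c`, and `n!/c` is the dimension of a right ideal. This
dimension is at least the number of standard tableaux of the shape, by exhibiting independent
elements, while the dimensions sum to at most `n!`. The hook length formula and `∑ 1/|Θ| = 1`, both
obtained from partial fractions of the Frobenius product, force equality throughout.

For irreducibility, `p x p` is always a multiple of `p`, so the range of `P_Θ` is irreducible under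
the commutant of `S_n`. A subspace stable under `SU(N)` is stable under that commutant: scalars lead
to `U(N)`, polynomials vanishing on a torus to the diagonal matrices, singular values to all
invertible matrices, and comparison of coefficients to every operator commuting with the
permutations (`stable_of_commute`). -/

theorem finite_groupAlgebra {G : Type*} [Finite G] : Module.Finite ℂ (MonoidAlgebra ℂ G) :=
  Module.Finite.equiv (MonoidAlgebra.coeffLinearEquiv ℂ).symm

/-- The basis of group elements of the group algebra. -/
def groupBasis {G : Type*} : Module.Basis G ℂ (MonoidAlgebra ℂ G) :=
  ⟨MonoidAlgebra.coeffLinearEquiv ℂ⟩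

theorem groupBasis_apply {G : Type*} (g : G) : groupBasis g = single g (1 : ℂ) := rfl

theorem groupBasis_repr {G : Type*} (x : MonoidAlgebra ℂ G) (g : G) :
    groupBasis.repr x g = x.coeff g := rfl

theorem single_eq_smul {G : Type*} (g : G) (c : ℂ) : single g c = c • single g (1 : ℂ) := by simp

variable {G : Type*} [Group G]

/-- The coefficient of the neutral element, as a linear functional on the group algebra. -/
def unitCoeff : MonoidAlgebra ℂ G →ₗ[ℂ] ℂ where
  toFun x := x.coeff 1
  map_add' x y := by simp
  map_smul' c x := by simp

theorem unitCoeff_apply (x : MonoidAlgebra ℂ G) : unitCoeff x = x.coeff 1 := rfl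

theorem unitCoeff_single [DecidableEq G] (g : G) (c : ℂ) :
    unitCoeff (single g c) = if g = 1 then c else 0 := by
  simp [unitCoeff_apply, Finsupp.single_apply]

theorem unitCoeff_one : unitCoeff (1 : MonoidAlgebra ℂ G) = 1 := by
  classical
  rw [MonoidAlgebra.one_def, unitCoeff_single, if_pos rfl]

theorem unitCoeff_mul_comm (x y : MonoidAlgebra ℂ G) :
    unitCoeff (x * y) = unitCoeff (y * x) := by
  classical
  induction x using MonoidAlgebra.induction_linear with
  | zero => simp
  | add a b ha hb => simp [add_mul, mul_add, ha, hb]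
  | single g c =>
    induction y using MonoidAlgebra.induction_linear with
    | zero => simp
    | add a b ha hb => simp [add_mul, mul_add, ha, hb]
    | single h d =>
      rw [single_mul_single, single_mul_single, unitCoeff_single, unitCoeff_single, mul_comm c d]
      congr 1
      rw [mul_eq_one_iff_eq_inv, mul_eq_one_iff_eq_inv', eq_iff_iff]

/-- In the basis of group elements every diagonal entry is the coefficient of `g` in `x g`, which is
the coefficient of `1` in `x`. -/
theorem trace_mulLeft [Fintype G] (x : MonoidAlgebra ℂ G) :
    LinearMap.trace ℂ _ (LinearMap.mulLeft ℂ x) = Fintype.card G * unitCoeff x := by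
  classical
  rw [LinearMap.trace_eq_matrix_trace ℂ groupBasis, Matrix.trace]
  have h : ∀ g : G, (LinearMap.toMatrix groupBasis groupBasis (LinearMap.mulLeft ℂ x)).diag g =
      unitCoeff x := by
    intro g
    rw [Matrix.diag_apply, LinearMap.toMatrix_apply, LinearMap.mulLeft_apply, groupBasis_repr,
      groupBasis_apply, unitCoeff_apply]
    simp
  rw [Finset.sum_congr rfl fun g _ => h g]
  simp

theorem trace_mulLeft_of_isIdempotentElem [Finite G] {e : MonoidAlgebra ℂ G}
    (he : IsIdempotentElem e) :
    LinearMap.trace ℂ _ (LinearMap.mulLeft ℂ e) =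
      Module.finrank ℂ (LinearMap.range (LinearMap.mulLeft ℂ e)) := by
  have := finite_groupAlgebra (G := G)
  have h : IsIdempotentElem (LinearMap.mulLeft ℂ e) := by
    rw [IsIdempotentElem, Module.End.mul_eq_comp, ← LinearMap.mulLeft_mul, he.eq]
  exact (LinearMap.IsIdempotentElem.isProj_range _ h).trace

theorem card_mul_unitCoeff [Fintype G] {e : MonoidAlgebra ℂ G} (he : IsIdempotentElem e) :
    (Fintype.card G : ℂ) * unitCoeff e =
      Module.finrank ℂ (LinearMap.range (LinearMap.mulLeft ℂ e)) := by
  rw [← trace_mulLeft, trace_mulLeft_of_isIdempotentElem he]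

/-- The trace of an idempotent is its rank, so a vanishing coefficient forces rank zero.
Completeness of the projectors rests on this. -/
theorem eq_zero_of_unitCoeff_eq_zero [Finite G] {e : MonoidAlgebra ℂ G}
    (he : IsIdempotentElem e) (h0 : unitCoeff e = 0) : e = 0 := by
  have := Fintype.ofFinite G
  have := finite_groupAlgebra (G := G)
  have h := card_mul_unitCoeff he
  rw [h0, mul_zero, eq_comm, Nat.cast_eq_zero, Submodule.finrank_eq_zero,
    LinearMap.range_eq_bot] at h
  simpa using LinearMap.congr_fun h 1

theorem unitCoeff_ne_zero [Finite G] {e : MonoidAlgebra ℂ G} (he : IsIdempotentElem e)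
    (h0 : e ≠ 0) : unitCoeff e ≠ 0 := fun h => h0 (eq_zero_of_unitCoeff_eq_zero he h)

/-- An element that squares to zero has vanishing coefficient at the neutral element. -/
theorem unitCoeff_eq_zero_of_mul_self [Finite G] {x : MonoidAlgebra ℂ G} (h : x * x = 0) :
    unitCoeff x = 0 := by
  have := Fintype.ofFinite G
  have := finite_groupAlgebra (G := G)
  have hn : IsNilpotent (LinearMap.mulLeft ℂ x) := by
    refine ⟨2, ?_⟩
    rw [pow_two, Module.End.mul_eq_comp, ← LinearMap.mulLeft_mul, h]
    ext; simp
  have ht := (LinearMap.isNilpotent_trace_of_isNilpotent hn).eq_zero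
  rw [trace_mulLeft] at ht
  exact (mul_eq_zero.1 ht).resolve_left (Nat.cast_ne_zero.2 Fintype.card_ne_zero)

/-- The conjugate-linear anti-involution of the group algebra that inverts group elements. -/
def adj : MonoidAlgebra ℂ G →+ MonoidAlgebra ℂ G :=
  MonoidAlgebra.liftNC
    ((algebraMap ℂ (MonoidAlgebra ℂ G)).toAddMonoidHom.comp (starRingEnd ℂ).toAddMonoidHom)
    fun g => single g⁻¹ 1

theorem adj_single (g : G) (c : ℂ) :
    adj (single g c) = single g⁻¹ (starRingEnd ℂ c) := by
  simp [adj, MonoidAlgebra.liftNC_single]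

theorem adj_one : adj (1 : MonoidAlgebra ℂ G) = 1 := by
  simp [MonoidAlgebra.one_def, adj_single]

theorem adj_mul (x y : MonoidAlgebra ℂ G) : adj (x * y) = adj y * adj x := by
  induction x using MonoidAlgebra.induction_linear with
  | zero => simp
  | add a b ha hb => simp [add_mul, mul_add, ha, hb]
  | single g c =>
    induction y using MonoidAlgebra.induction_linear with
    | zero => simp
    | add a b ha hb => simp [add_mul, mul_add, ha, hb]
    | single h d => simp [adj_single, single_mul_single, mul_comm]

theorem adj_smul (c : ℂ) (x : MonoidAlgebra ℂ G) : adj (c • x) = starRingEnd ℂ c • adj x := by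
  induction x using MonoidAlgebra.induction_linear with
  | zero => simp
  | add a b ha hb => simp [ha, hb]
  | single g d => simp [adj_single]

theorem adj_adj (x : MonoidAlgebra ℂ G) : adj (adj x) = x := by
  induction x using MonoidAlgebra.induction_linear with
  | zero => simp
  | add a b ha hb => simp [ha, hb]
  | single g c => simp [adj_single]

end GroupAlgebra

/-! ### Young symmetrizers and von Neumann's lemma -/

namespace StandardTableau

open MonoidAlgebra Equiv.Perm

variable {n : ℕ} (Θ Φ : StandardTableau n)

theorem mem_rowPerms {σ : Equiv.Perm (Fin n)} :
    σ ∈ Θ.rowPerms ↔ ∀ k, (Θ.pos (σ k)).1 = (Θ.pos k).1 := by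
  simp [rowPerms]

theorem mem_colPerms {σ : Equiv.Perm (Fin n)} :
    σ ∈ Θ.colPerms ↔ ∀ k, (Θ.pos (σ k)).2 = (Θ.pos k).2 := by
  simp [colPerms]

theorem one_mem_rowPerms : 1 ∈ Θ.rowPerms := by simp [mem_rowPerms]

theorem one_mem_colPerms : 1 ∈ Θ.colPerms := by simp [mem_colPerms]

theorem mul_mem_rowPerms {σ τ : Equiv.Perm (Fin n)} (hσ : σ ∈ Θ.rowPerms) :
    σ * τ ∈ Θ.rowPerms ↔ τ ∈ Θ.rowPerms := by
  simp only [mem_rowPerms, Equiv.Perm.mul_apply] at hσ ⊢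
  simp only [hσ]

theorem mul_mem_colPerms {σ τ : Equiv.Perm (Fin n)} (hσ : σ ∈ Θ.colPerms) :
    σ * τ ∈ Θ.colPerms ↔ τ ∈ Θ.colPerms := by
  simp only [mem_colPerms, Equiv.Perm.mul_apply] at hσ ⊢
  simp only [hσ]

theorem inv_mem_rowPerms {σ : Equiv.Perm (Fin n)} : σ⁻¹ ∈ Θ.rowPerms ↔ σ ∈ Θ.rowPerms := by
  simp only [mem_rowPerms]
  constructor
  · intro h k
    simpa using (h (σ k)).symm
  · intro h k
    simpa using (h (σ⁻¹ k)).symm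

theorem inv_mem_colPerms {σ : Equiv.Perm (Fin n)} : σ⁻¹ ∈ Θ.colPerms ↔ σ ∈ Θ.colPerms := by
  simp only [mem_colPerms]
  constructor
  · intro h k
    simpa using (h (σ k)).symm
  · intro h k
    simpa using (h (σ⁻¹ k)).symm

theorem single_mul_rowSymmetrizer {σ : Equiv.Perm (Fin n)} (hσ : σ ∈ Θ.rowPerms) :
    single σ 1 * Θ.rowSymmetrizer = Θ.rowSymmetrizer := by
  rw [rowSymmetrizer, Finset.mul_sum]
  refine Finset.sum_equiv (Equiv.mulLeft σ) (fun τ => ?_) fun τ _ => ?_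
  · simp [mul_mem_rowPerms Θ hσ]
  · simp [single_mul_single]

theorem single_mul_colAntisymmetrizer {σ : Equiv.Perm (Fin n)} (hσ : σ ∈ Θ.colPerms) :
    single σ 1 * Θ.colAntisymmetrizer = ((sign σ : ℤ) : ℂ) • Θ.colAntisymmetrizer := by
  rw [colAntisymmetrizer, Finset.mul_sum, Finset.smul_sum]
  refine Finset.sum_equiv (Equiv.mulLeft σ) (fun τ => ?_) fun τ _ => ?_
  · simp [mul_mem_colPerms Θ hσ]
  · simp only [single_mul_single, Equiv.coe_mulLeft, smul_single, smul_eq_mul, one_mul]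
    rw [← Int.cast_mul, ← Units.val_mul, Equiv.Perm.sign_mul, ← mul_assoc, Int.units_mul_self,
      one_mul]

theorem adj_rowSymmetrizer : adj Θ.rowSymmetrizer = Θ.rowSymmetrizer := by
  rw [rowSymmetrizer, map_sum]
  refine Finset.sum_equiv (Equiv.inv _) (fun τ => ?_) fun τ _ => ?_
  · simp [inv_mem_rowPerms Θ]
  · simp [adj_single]

theorem adj_colAntisymmetrizer : adj Θ.colAntisymmetrizer = Θ.colAntisymmetrizer := by
  rw [colAntisymmetrizer, map_sum]
  refine Finset.sum_equiv (Equiv.inv _) (fun τ => ?_) fun τ _ => ?_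
  · simp [inv_mem_colPerms Θ]
  · simp [adj_single]

theorem rowSymmetrizer_mul_single {σ : Equiv.Perm (Fin n)} (hσ : σ ∈ Θ.rowPerms) :
    Θ.rowSymmetrizer * single σ 1 = Θ.rowSymmetrizer := by
  have h := congrArg adj (Θ.single_mul_rowSymmetrizer ((inv_mem_rowPerms Θ).2 hσ))
  simpa [adj_mul, adj_rowSymmetrizer, adj_single] using h

theorem colAntisymmetrizer_mul_single {σ : Equiv.Perm (Fin n)} (hσ : σ ∈ Θ.colPerms) :
    Θ.colAntisymmetrizer * single σ 1 = ((sign σ : ℤ) : ℂ) • Θ.colAntisymmetrizer := by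
  have h := congrArg adj (Θ.single_mul_colAntisymmetrizer ((inv_mem_colPerms Θ).2 hσ))
  simpa [adj_mul, adj_colAntisymmetrizer, adj_single, adj_smul] using h

/-- The transposition of `i` and `j` is absorbed on the left with sign `+1`; carried through `g` it
is absorbed on the right with sign `-1`. The product therefore equals its own negative. -/
theorem rowSymmetrizer_mul_single_mul_eq_zero {g : Equiv.Perm (Fin n)} {i j : Fin n} (hij : i ≠ j)
    (hrow : (Θ.pos i).1 = (Θ.pos j).1) (hcol : (Φ.pos (g⁻¹ i)).2 = (Φ.pos (g⁻¹ j)).2) :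
    Θ.rowSymmetrizer * single g 1 * Φ.colAntisymmetrizer = 0 := by
  have h1 : Equiv.swap i j ∈ Θ.rowPerms := by
    rw [mem_rowPerms]
    intro k
    by_cases hi : k = i
    · rw [hi, Equiv.swap_apply_left, hrow]
    by_cases hj : k = j
    · rw [hj, Equiv.swap_apply_right, hrow]
    rw [Equiv.swap_apply_of_ne_of_ne hi hj]
  have h2 : Equiv.swap (g⁻¹ i) (g⁻¹ j) ∈ Φ.colPerms := by
    rw [mem_colPerms]
    intro k
    by_cases hi : k = g⁻¹ i
    · rw [hi, Equiv.swap_apply_left, hcol]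
    by_cases hj : k = g⁻¹ j
    · rw [hj, Equiv.swap_apply_right, hcol]
    rw [Equiv.swap_apply_of_ne_of_ne hi hj]
  have h3 : Equiv.swap i j * g = g * Equiv.swap (g⁻¹ i) (g⁻¹ j) := by
    rw [Equiv.mul_swap_eq_swap_mul]
    simp
  have h4 : Θ.rowSymmetrizer * single g 1 * Φ.colAntisymmetrizer =
      -(Θ.rowSymmetrizer * single g 1 * Φ.colAntisymmetrizer) := by
    conv_lhs => rw [← Θ.rowSymmetrizer_mul_single h1]
    rw [mul_assoc Θ.rowSymmetrizer, single_mul_single, h3, ← one_mul (1 * 1 : ℂ), mul_one,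
      ← single_mul_single, ← mul_assoc, mul_assoc _ (single _ _) Φ.colAntisymmetrizer,
      Φ.single_mul_colAntisymmetrizer h2, sign_swap (by simpa using hij)]
    simp
  have h5 : (2 : ℂ) • (Θ.rowSymmetrizer * single g 1 * Φ.colAntisymmetrizer) = 0 := by
    rw [two_smul]
    nth_rewrite 1 [h4]
    exact neg_add_cancel _
  exact (smul_eq_zero.1 h5).resolve_left two_ne_zero

theorem image_pos : Finset.univ.image Θ.pos = Θ.shape.cells := by
  ext c
  simp [Θ.mem_shape_iff c]

/-- The sum of the row indices of the boxes; it serves as a substitute for the dominance order. -/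
def rowSum : ℕ := ∑ i, (Θ.pos i).1

/-- Give the box `(i, j)` the weight `i - colLen j`, with column lengths from `Φ`: it is nonnegative
outside the diagram of `Φ` and at most `-1` inside. The image of the map and the diagram have the
same multiset of columns, so their total weights differ by the difference of the row sums, and each
missed box contributes at least one. -/
theorem rowSum_add_card_le (g : Equiv.Perm (Fin n))
    (hF : Function.Injective fun i => ((Θ.pos i).1, (Φ.pos (g⁻¹ i)).2)) :
    Φ.rowSum + (Φ.shape.cells \ Finset.univ.image
      fun i => ((Θ.pos i).1, (Φ.pos (g⁻¹ i)).2)).card ≤ Θ.rowSum := by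
  set F : Fin n → ℕ × ℕ := fun i => ((Θ.pos i).1, (Φ.pos (g⁻¹ i)).2) with hFdef
  set S := Finset.univ.image F
  set w : ℕ × ℕ → ℤ := fun c => c.1 - Φ.shape.colLen c.2 with hw
  have hcol : ∑ i, (Φ.shape.colLen (Φ.pos (g⁻¹ i)).2 : ℤ) =
      ∑ i, (Φ.shape.colLen (Φ.pos i).2 : ℤ) :=
    Equiv.sum_comp g⁻¹ fun i => (Φ.shape.colLen (Φ.pos i).2 : ℤ)
  have hS : ∑ c ∈ S, w c = Θ.rowSum - ∑ i, (Φ.shape.colLen (Φ.pos i).2 : ℤ) := by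
    rw [Finset.sum_image fun a _ b _ h => hF h, ← hcol, rowSum]
    simp [hw, hFdef]
  have hM : ∑ c ∈ Φ.shape.cells, w c = Φ.rowSum - ∑ i, (Φ.shape.colLen (Φ.pos i).2 : ℤ) := by
    rw [← image_pos, Finset.sum_image fun a _ b _ h => Φ.pos_injective h, rowSum]
    simp [hw]
  have h1 : 0 ≤ ∑ c ∈ S \ Φ.shape.cells, w c := by
    refine Finset.sum_nonneg fun c hc => ?_
    have := (Finset.mem_sdiff.1 hc).2
    rw [YoungDiagram.mem_cells, ← Prod.mk.eta (p := c), YoungDiagram.mem_iff_lt_colLen] at this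
    simp only [hw]
    omega
  have h2 : ∑ c ∈ Φ.shape.cells \ S, w c ≤ ∑ c ∈ Φ.shape.cells \ S, (-1) := by
    refine Finset.sum_le_sum fun c hc => ?_
    have := (Finset.mem_sdiff.1 hc).1
    rw [YoungDiagram.mem_cells, ← Prod.mk.eta (p := c), YoungDiagram.mem_iff_lt_colLen] at this
    simp only [hw]
    omega
  have h3 := Finset.sum_sdiff_sub_sum_sdiff (s₁ := S) (s₂ := Φ.shape.cells) (f := w)
  simp only [Finset.sum_const, nsmul_eq_mul] at h2
  zify
  linarith

theorem rowLen_eq_card_filter (k : ℕ) :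
    Θ.shape.rowLen k = (Finset.univ.filter fun i => (Θ.pos i).1 = k).card := by
  rw [YoungDiagram.rowLen_eq_card, YoungDiagram.row, ← image_pos, Finset.filter_image,
    Finset.card_image_of_injective _ Θ.pos_injective]

theorem image_eq_cells_of_rowSum_le {g : Equiv.Perm (Fin n)}
    (hF : Function.Injective fun i => ((Θ.pos i).1, (Φ.pos (g⁻¹ i)).2))
    (h : Θ.rowSum ≤ Φ.rowSum) :
    (Finset.univ.image fun i => ((Θ.pos i).1, (Φ.pos (g⁻¹ i)).2)) = Φ.shape.cells := by
  have h1 := rowSum_add_card_le Θ Φ g hF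
  have h2 : (Φ.shape.cells \ Finset.univ.image
      fun i => ((Θ.pos i).1, (Φ.pos (g⁻¹ i)).2)).card = 0 := by omega
  rw [Finset.card_eq_zero, Finset.sdiff_eq_empty_iff_subset] at h2
  refine (Finset.eq_of_subset_of_card_le h2 ?_).symm
  rw [Finset.card_image_of_injective _ hF]
  have := Φ.card_shape
  rw [YoungDiagram.card] at this
  simp [this]

/-- The image is the diagram of `Φ`, yet its boxes have the row indices of the boxes of `Θ`; so all
row lengths agree. -/
theorem shape_eq_of_injective {g : Equiv.Perm (Fin n)}
    (hF : Function.Injective fun i => ((Θ.pos i).1, (Φ.pos (g⁻¹ i)).2))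
    (h : Θ.rowSum ≤ Φ.rowSum) : Θ.shape = Φ.shape := by
  have h1 := image_eq_cells_of_rowSum_le Θ Φ hF h
  have h2 : ∀ k, Θ.shape.rowLen k = Φ.shape.rowLen k := by
    intro k
    rw [Θ.rowLen_eq_card_filter, YoungDiagram.rowLen_eq_card, YoungDiagram.row, ← h1,
      Finset.filter_image, Finset.card_image_of_injective _ hF]
  ext ⟨i, j⟩
  rw [YoungDiagram.mem_cells, YoungDiagram.mem_cells, YoungDiagram.mem_iff_lt_rowLen,
    YoungDiagram.mem_iff_lt_rowLen, h2]

/-- A permutation that sends no two entries of a column to the same row is the product of a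
horizontal and a vertical permutation. -/
theorem exists_eq_mul_of_injective {g : Equiv.Perm (Fin n)}
    (hF : Function.Injective fun i => ((Θ.pos i).1, (Θ.pos (g⁻¹ i)).2)) :
    ∃ σ ∈ Θ.rowPerms, ∃ τ ∈ Θ.colPerms, g = σ * τ := by
  have h1 := image_eq_cells_of_rowSum_le Θ Θ hF le_rfl
  -- Move `i` within its row to the column of `g⁻¹ i`; the required box exists because the image
  -- fills the diagram. Following `g` by this horizontal permutation preserves columns.
  have h2 : ∀ i, ∃ k, Θ.pos k = ((Θ.pos i).1, (Θ.pos (g⁻¹ i)).2) := by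
    intro i
    rw [← Θ.mem_shape_iff, ← YoungDiagram.mem_cells, ← h1]
    exact Finset.mem_image_of_mem _ (Finset.mem_univ i)
  choose u hu using h2
  have hinj : Function.Injective u := fun i j hij => hF (by
    simp only [← hu, hij])
  let σ : Equiv.Perm (Fin n) := Equiv.ofBijective u (Finite.injective_iff_bijective.1 hinj)
  have hσ : ∀ i, Θ.pos (σ i) = ((Θ.pos i).1, (Θ.pos (g⁻¹ i)).2) := hu
  refine ⟨σ⁻¹, ?_, σ * g, ?_, by group⟩
  · rw [inv_mem_rowPerms, mem_rowPerms]
    intro k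
    rw [hσ]
  · rw [mem_colPerms]
    intro k
    rw [Equiv.Perm.mul_apply, hσ]
    simp

theorem rowSymmetrizer_mul_single_mul_eq_zero_of_not_injective {g : Equiv.Perm (Fin n)}
    (h : ¬ Function.Injective fun i => ((Θ.pos i).1, (Φ.pos (g⁻¹ i)).2)) :
    Θ.rowSymmetrizer * single g 1 * Φ.colAntisymmetrizer = 0 := by
  simp only [Function.Injective, not_forall] at h
  obtain ⟨i, j, h1, h2⟩ := h
  rw [Prod.mk.injEq] at h1
  exact rowSymmetrizer_mul_single_mul_eq_zero Θ Φ h2 h1.1 h1.2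

/-- By linearity `x` is a permutation `g`. Either `g` is horizontal times vertical and both factors
are absorbed, or two entries of a row come from one column and the product vanishes. -/
theorem rowSymmetrizer_mul_mul_colAntisymmetrizer (x : MonoidAlgebra ℂ (Equiv.Perm (Fin n))) :
    ∃ c : ℂ, Θ.rowSymmetrizer * x * Θ.colAntisymmetrizer =
      c • (Θ.rowSymmetrizer * Θ.colAntisymmetrizer) := by
  induction x using MonoidAlgebra.induction_linear with
  | zero => exact ⟨0, by simp⟩
  | add x y hx hy =>
    obtain ⟨c, hc⟩ := hx
    obtain ⟨d, hd⟩ := hy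
    exact ⟨c + d, by rw [mul_add, add_mul, hc, hd, add_smul]⟩
  | single g r =>
    suffices h : ∃ c : ℂ, Θ.rowSymmetrizer * single g 1 * Θ.colAntisymmetrizer =
        c • (Θ.rowSymmetrizer * Θ.colAntisymmetrizer) by
      obtain ⟨c, hc⟩ := h
      refine ⟨r * c, ?_⟩
      rw [mul_smul, ← hc, single_eq_smul, mul_smul_comm, smul_mul_assoc]
    by_cases hF : Function.Injective fun i => ((Θ.pos i).1, (Θ.pos (g⁻¹ i)).2)
    · obtain ⟨σ, hσ, τ, hτ, rfl⟩ := Θ.exists_eq_mul_of_injective hF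
      refine ⟨((sign τ : ℤ) : ℂ), ?_⟩
      rw [← one_mul (1 : ℂ), ← single_mul_single, ← mul_assoc, Θ.rowSymmetrizer_mul_single hσ,
        mul_assoc, Θ.single_mul_colAntisymmetrizer hτ, mul_smul_comm]
    · exact ⟨0, by rw [rowSymmetrizer_mul_single_mul_eq_zero_of_not_injective Θ Θ hF, zero_smul]⟩

theorem rowSymmetrizer_mul_mul_eq_zero (hs : Θ.shape ≠ Φ.shape) (h : Θ.rowSum ≤ Φ.rowSum)
    (x : MonoidAlgebra ℂ (Equiv.Perm (Fin n))) :
    Θ.rowSymmetrizer * x * Φ.colAntisymmetrizer = 0 := by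
  induction x using MonoidAlgebra.induction_linear with
  | zero => simp
  | add x y hx hy => rw [mul_add, add_mul, hx, hy, add_zero]
  | single g r =>
    rw [single_eq_smul, mul_smul_comm, smul_mul_assoc,
      rowSymmetrizer_mul_single_mul_eq_zero_of_not_injective Θ Φ
        fun hF => hs (shape_eq_of_injective Θ Φ hF h), smul_zero]

/-- The unnormalized Young symmetrizer. -/
def sym : MonoidAlgebra ℂ (Equiv.Perm (Fin n)) := Θ.rowSymmetrizer * Θ.colAntisymmetrizer

theorem sym_mul_mul_sym_of_shape_ne (hs : Θ.shape ≠ Φ.shape)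
    (x : MonoidAlgebra ℂ (Equiv.Perm (Fin n))) : Θ.sym * x * Φ.sym = 0 := by
  rcases le_total Θ.rowSum Φ.rowSum with h | h
  · have := rowSymmetrizer_mul_mul_eq_zero Θ Φ hs h (Θ.colAntisymmetrizer * x * Φ.rowSymmetrizer)
    simpa only [sym, mul_assoc] using this
  -- With the opposite order of row sums the vanishing product is the inner one, `a_Θ x s_Φ`,
  -- reached by taking adjoints.
  · have := congrArg adj (rowSymmetrizer_mul_mul_eq_zero Φ Θ hs.symm h (adj x))
    rw [adj_mul, adj_mul, adj_adj, adj_rowSymmetrizer, adj_colAntisymmetrizer, map_zero] at this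
    calc Θ.sym * x * Φ.sym = Θ.rowSymmetrizer *
        (Θ.colAntisymmetrizer * (x * Φ.rowSymmetrizer)) * Φ.colAntisymmetrizer := by
          simp only [sym, mul_assoc]
      _ = 0 := by rw [this]; simp

theorem eq_one_of_mem_rowPerms_of_mem_colPerms {σ : Equiv.Perm (Fin n)} (h1 : σ ∈ Θ.rowPerms)
    (h2 : σ ∈ Θ.colPerms) : σ = 1 := by
  rw [mem_rowPerms] at h1
  rw [mem_colPerms] at h2
  ext k
  rw [Θ.pos_injective (Prod.ext (h1 k) (h2 k))]
  rfl

/-- A horizontal and a vertical permutation multiply to `1` only if both are `1`, so a single term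
of the double sum contributes. -/
theorem unitCoeff_sym : unitCoeff Θ.sym = 1 := by
  rw [sym, rowSymmetrizer, colAntisymmetrizer, Finset.sum_mul_sum, map_sum]
  simp only [map_sum, single_mul_single, unitCoeff_single]
  rw [Finset.sum_eq_single 1, Finset.sum_eq_single 1]
  · simp
  · intro τ _ hτ
    simp [hτ]
  · exact fun h => absurd Θ.one_mem_colPerms h
  · intro σ hσ h1
    refine Finset.sum_eq_zero fun τ hτ => if_neg fun h => h1 ?_
    rw [mul_eq_one_iff_eq_inv] at h
    exact Θ.eq_one_of_mem_rowPerms_of_mem_colPerms hσ (h ▸ (inv_mem_colPerms Θ).2 hτ)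
  · exact fun h => absurd Θ.one_mem_rowPerms h

/-- Were the constant zero, left multiplication by `sym` would be nilpotent and hence traceless, but
the coefficient at `1` is `1`. -/
theorem exists_sym_mul_self : ∃ c : ℂ, c ≠ 0 ∧ Θ.sym * Θ.sym = c • Θ.sym := by
  obtain ⟨c, hc⟩ := Θ.rowSymmetrizer_mul_mul_colAntisymmetrizer
    (Θ.colAntisymmetrizer * Θ.rowSymmetrizer)
  have h : Θ.sym * Θ.sym = c • Θ.sym := by simpa only [sym, mul_assoc] using hc
  refine ⟨c, ?_, h⟩
  rintro rfl
  rw [zero_smul] at h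
  have := unitCoeff_eq_zero_of_mul_self h
  rw [unitCoeff_sym] at this
  exact one_ne_zero this

/-- The nonzero constant by which the Young symmetrizer differs from its square. -/
def symConst : ℂ := Θ.exists_sym_mul_self.choose

theorem symConst_ne_zero : Θ.symConst ≠ 0 := Θ.exists_sym_mul_self.choose_spec.1

theorem sym_mul_sym : Θ.sym * Θ.sym = Θ.symConst • Θ.sym := Θ.exists_sym_mul_self.choose_spec.2

/-- The Young symmetrizer, normalized so that it is idempotent. -/
def normYoung : MonoidAlgebra ℂ (Equiv.Perm (Fin n)) := Θ.symConst⁻¹ • Θ.sym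

theorem isIdempotentElem_normYoung : IsIdempotentElem Θ.normYoung := by
  rw [IsIdempotentElem, normYoung, smul_mul_assoc, mul_smul_comm, sym_mul_sym, smul_smul _ _ Θ.sym,
    inv_mul_cancel₀ Θ.symConst_ne_zero, one_smul]

theorem unitCoeff_normYoung : unitCoeff Θ.normYoung = Θ.symConst⁻¹ := by
  rw [normYoung, map_smul, unitCoeff_sym, smul_eq_mul, mul_one]

theorem sym_mul_mul_sym (x : MonoidAlgebra ℂ (Equiv.Perm (Fin n))) :
    ∃ c : ℂ, Θ.sym * x * Θ.sym = c • Θ.sym := by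
  obtain ⟨c, hc⟩ := Θ.rowSymmetrizer_mul_mul_colAntisymmetrizer
    (Θ.colAntisymmetrizer * x * Θ.rowSymmetrizer)
  exact ⟨c, by simpa only [sym, mul_assoc] using hc⟩

end StandardTableau

/-! ### Partial fractions of `∏ (1 - 1/(m - x_j))` -/

section PartialFractions

variable {ι K : Type*} [DecidableEq ι] [Field K]

/-- The residue at `x i` of `∏ j ∈ s, (1 - 1 / (m - x j))`, up to sign. -/
def residue (s : Finset ι) (x : ι → K) (i : ι) : K := ∏ j ∈ s.erase i, (1 - (x i - x j)⁻¹)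

theorem sum_residue_insert (s : Finset ι) (x f : ι → K) {k : ι} (hk : k ∉ s) :
    ∑ i ∈ insert k s, residue (insert k s) x i * f i =
      (∏ j ∈ s, (1 - (x k - x j)⁻¹)) * f k +
        ∑ i ∈ s, residue s x i * (1 - (x i - x k)⁻¹) * f i := by
  rw [Finset.sum_insert hk, residue, Finset.erase_insert hk]
  congr 1
  refine Finset.sum_congr rfl fun i hi => ?_
  have hik : k ≠ i := fun h => hk (h ▸ hi)
  rw [residue, Finset.erase_insert_of_ne hik, Finset.prod_insert
    fun h => hk (Finset.mem_of_mem_erase h), residue]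
  ring

theorem sum_residue_mul_inv (s : Finset ι) (x : ι → K) (hx : Set.InjOn x s) (m : K)
    (hm : ∀ i ∈ s, m ≠ x i) :
    ∑ i ∈ s, residue s x i * (m - x i)⁻¹ = 1 - ∏ j ∈ s, (1 - (m - x j)⁻¹) := by
  induction s using Finset.induction_on generalizing m with
  | empty => simp
  | insert k s hk ih =>
    have hs : Set.InjOn x s := hx.mono (by simp)
    have hmk : m - x k ≠ 0 := sub_ne_zero.2 (hm k (by simp))
    have hms : ∀ i ∈ s, m ≠ x i := fun i hi => hm i (by simp [hi])
    have hks : ∀ i ∈ s, x k ≠ x i := fun i hi h =>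
      hk (hx (by simp) (by simp [hi]) h ▸ hi)
    have ih1 := ih hs m hms
    have ih2 := ih hs (x k) hks
    rw [sum_residue_insert s x _ hk, Finset.prod_insert hk]
    have h : ∀ i ∈ s, residue s x i * (1 - (x i - x k)⁻¹) * (m - x i)⁻¹ =
        residue s x i * (m - x i)⁻¹ + (m - x k)⁻¹ * (residue s x i * (x k - x i)⁻¹) -
          (m - x k)⁻¹ * (residue s x i * (m - x i)⁻¹) := by
      intro i hi
      have h1 : m - x i ≠ 0 := sub_ne_zero.2 (hms i hi)
      have h2 : x k - x i ≠ 0 := sub_ne_zero.2 (hks i hi)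
      have h3 : (x i - x k)⁻¹ = -(x k - x i)⁻¹ := by rw [← inv_neg, neg_sub]
      have h4 : (x k - x i)⁻¹ * (m - x i)⁻¹ =
          (m - x k)⁻¹ * (x k - x i)⁻¹ - (m - x k)⁻¹ * (m - x i)⁻¹ := by
        field_simp
        ring
      rw [h3]
      linear_combination (residue s x i) * h4
    rw [Finset.sum_congr rfl h, Finset.sum_sub_distrib, Finset.sum_add_distrib, ← Finset.mul_sum,
      ← Finset.mul_sum, ih1, ih2]
    ring

/-- Corresponds to the coefficient of `1/m` in the expansion of the partial fractions at infinity.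
-/
theorem sum_residue (s : Finset ι) (x : ι → K) (hx : Set.InjOn x s) :
    ∑ i ∈ s, residue s x i = s.card := by
  induction s using Finset.induction_on with
  | empty => simp
  | insert k s hk ih =>
    have hs : Set.InjOn x s := hx.mono (by simp)
    have hks : ∀ i ∈ s, x k ≠ x i := fun i hi h =>
      hk (hx (by simp) (by simp [hi]) h ▸ hi)
    have h0 := sum_residue_insert s x (fun _ => 1) hk
    simp only [mul_one] at h0
    have h : ∀ i ∈ s, residue s x i * (1 - (x i - x k)⁻¹) =
        residue s x i + residue s x i * (x k - x i)⁻¹ := by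
      intro i _
      have h3 : (x i - x k)⁻¹ = -(x k - x i)⁻¹ := by rw [← inv_neg, neg_sub]
      rw [h3]
      ring
    rw [h0, Finset.sum_congr rfl h, Finset.sum_add_distrib, ih hs,
      sum_residue_mul_inv s x hs _ hks, Finset.card_insert_of_notMem hk]
    push_cast
    ring

/-- Corresponds to the coefficient of `1/m²` at infinity; the factor `2` avoids a division in `K`.
-/
theorem two_mul_sum_residue_mul (s : Finset ι) (x : ι → K) (hx : Set.InjOn x s) :
    2 * ∑ i ∈ s, residue s x i * x i = 2 * ∑ i ∈ s, x i - s.card * (s.card - 1) := by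
  induction s using Finset.induction_on with
  | empty => simp
  | insert k s hk ih =>
    have hs : Set.InjOn x s := hx.mono (by simp)
    have hks : ∀ i ∈ s, x k ≠ x i := fun i hi h =>
      hk (hx (by simp) (by simp [hi]) h ▸ hi)
    have h : ∀ i ∈ s, residue s x i * (1 - (x i - x k)⁻¹) * x i =
        residue s x i * x i + x k * (residue s x i * (x k - x i)⁻¹) - residue s x i := by
      intro i hi
      have h2 : x k - x i ≠ 0 := sub_ne_zero.2 (hks i hi)
      have h3 : (x i - x k)⁻¹ = -(x k - x i)⁻¹ := by rw [← inv_neg, neg_sub]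
      rw [h3]
      field_simp
      ring
    rw [sum_residue_insert s x _ hk, Finset.sum_congr rfl h, Finset.sum_sub_distrib,
      Finset.sum_add_distrib, ← Finset.mul_sum, sum_residue_mul_inv s x hs _ hks,
      sum_residue s x hs, Finset.card_insert_of_notMem hk, Finset.sum_insert hk]
    push_cast
    linear_combination ih hs

end PartialFractions

/-! ### The Frobenius product under adding and removing a box -/

section Frobenius

/-- The Frobenius expression `∏_{i < j} (l_i - l_j) / ∏_i l_i!` for the inverse hook product. -/
def frobenius (r : ℕ) (l : ℕ → ℕ) : ℚ :=
  (∏ i ∈ Finset.range r, ∏ j ∈ Finset.Ioo i r, ((l i : ℚ) - l j)) /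
    ∏ i ∈ Finset.range r, ((l i).factorial : ℚ)

theorem prod_Ioo_eq_prod_erase {r k : ℕ} (hk : k < r) (F : ℕ → ℕ → ℚ) (φ : ℕ → ℚ)
    (h1 : ∀ j, j ≠ k → F k j = φ j) (h2 : ∀ i, i ≠ k → F i k = φ i)
    (h3 : ∀ i j, i ≠ k → j ≠ k → F i j = 1) :
    ∏ i ∈ Finset.range r, ∏ j ∈ Finset.Ioo i r, F i j =
      ∏ j ∈ (Finset.range r).erase k, φ j := by
  have hk' : k ∈ Finset.range r := Finset.mem_range.2 hk
  rw [← Finset.mul_prod_erase _ _ hk']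
  have h4 : ∀ i ∈ (Finset.range r).erase k, ∏ j ∈ Finset.Ioo i r, F i j =
      if i < k then φ i else 1 := by
    intro i hi
    have hik := Finset.ne_of_mem_erase hi
    split_ifs with h
    · rw [← h2 i hik]
      exact Finset.prod_eq_single_of_mem k (Finset.mem_Ioo.2 ⟨h, hk⟩) fun j _ hj => h3 i j hik hj
    · refine Finset.prod_eq_one fun j hj => h3 i j hik ?_
      rintro rfl
      exact h (Finset.mem_Ioo.1 hj).1
  have h5 : ∏ j ∈ Finset.Ioo k r, F k j =
      ∏ j ∈ (Finset.range r).erase k, if j < k then 1 else φ j := by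
    rw [Finset.prod_ite, Finset.prod_const_one, one_mul]
    have : Finset.Ioo k r = ((Finset.range r).erase k).filter fun j => ¬ j < k := by
      ext j
      simp only [Finset.mem_Ioo, Finset.mem_filter, Finset.mem_erase, Finset.mem_range]
      omega
    rw [← this]
    exact Finset.prod_congr rfl fun j hj => h1 j (Finset.mem_Ioo.1 hj).1.ne'
  rw [Finset.prod_congr rfl h4, h5, ← Finset.prod_mul_distrib]
  refine Finset.prod_congr rfl fun j _ => ?_
  split_ifs <;> simp

/-- Only the factors that involve `k` change, and in a quotient of differences the order of the pair
is irrelevant, so the pairs before and after `k` look alike. -/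
theorem frobenius_ratio {r k : ℕ} (hk : k < r) {l l' : ℕ → ℕ} (hl : Set.InjOn l (Finset.range r))
    (h : ∀ i, i ≠ k → l' i = l i) :
    frobenius r l' = frobenius r l * ((l k).factorial / (l' k).factorial) *
      ∏ j ∈ (Finset.range r).erase k, (((l' k : ℚ) - l j) / ((l k : ℚ) - l j)) := by
  have hne : ∀ i ∈ Finset.range r, ∀ j ∈ Finset.Ioo i r, (l i : ℚ) - l j ≠ 0 := by
    intro i hi j hj
    rw [Finset.mem_Ioo] at hj
    refine sub_ne_zero.2 fun he => hj.1.ne (hl (by simpa using hi) (by simpa using hj.2) ?_)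
    exact_mod_cast he
  have hnum : ∏ i ∈ Finset.range r, ∏ j ∈ Finset.Ioo i r, ((l' i : ℚ) - l' j) =
      (∏ i ∈ Finset.range r, ∏ j ∈ Finset.Ioo i r, ((l i : ℚ) - l j)) *
      ∏ j ∈ (Finset.range r).erase k, (((l' k : ℚ) - l j) / ((l k : ℚ) - l j)) := by
    let F : ℕ → ℕ → ℚ := fun i j => if i = k ∨ j = k then
      ((l' i : ℚ) - l' j) / ((l i : ℚ) - l j) else 1
    rw [← prod_Ioo_eq_prod_erase hk F, ← Finset.prod_mul_distrib]
    · refine Finset.prod_congr rfl fun i hi => ?_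
      rw [← Finset.prod_mul_distrib]
      refine Finset.prod_congr rfl fun j hj => ?_
      have := hne i hi j hj
      simp only [F]
      split_ifs with hc
      · field_simp
      · rw [not_or] at hc
        rw [h i hc.1, h j hc.2, mul_one]
    · intro j hj
      simp [F, h j hj]
    · intro i hi
      simp only [F, or_true, if_true]
      rw [h i hi, ← neg_sub (l' k : ℚ), ← neg_sub (l k : ℚ), neg_div_neg_eq]
    · intro i j hi hj
      simp [F, hi, hj]
  have hk' : k ∈ Finset.range r := Finset.mem_range.2 hk
  have hden : ∏ i ∈ Finset.range r, ((l' i).factorial : ℚ) =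
      (∏ i ∈ Finset.range r, ((l i).factorial : ℚ)) * ((l' k).factorial / (l k).factorial) := by
    rw [← Finset.mul_prod_erase _ _ hk', ← Finset.mul_prod_erase _ (fun i => ((l i).factorial : ℚ))
      hk', Finset.prod_congr rfl fun i hi => by rw [h i (Finset.ne_of_mem_erase hi)]]
    have := (l k).factorial_ne_zero
    field_simp
  rw [frobenius, frobenius, hnum, hden]
  have h1 : (∏ i ∈ Finset.range r, ((l i).factorial : ℚ)) ≠ 0 :=
    Finset.prod_ne_zero_iff.2 fun i _ => Nat.cast_ne_zero.2 (l i).factorial_ne_zero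
  have h2 : ((l k).factorial : ℚ) ≠ 0 := Nat.cast_ne_zero.2 (l k).factorial_ne_zero
  have h3 : ((l' k).factorial : ℚ) ≠ 0 := Nat.cast_ne_zero.2 (l' k).factorial_ne_zero
  field_simp

/-- Divided by `frobenius r l`, the left side is the partial fraction sum with nodes `-l i` at `m =
1`. The entry `l i = 0` makes a factor `1 - 1/(1 + l i)` of the product vanish, so the sum is `1`.
-/
theorem sum_frobenius_add (r : ℕ) (l : ℕ → ℕ) (hl : Set.InjOn l (Finset.range r))
    (h0 : ∃ i < r, l i = 0) :
    ∑ k ∈ Finset.range r, frobenius r (Function.update l k (l k + 1)) = frobenius r l := by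
  have hx : Set.InjOn (fun i => -(l i : ℚ)) (Finset.range r) := by
    intro i hi j hj hij
    refine hl hi hj ?_
    simpa using hij
  have hp := sum_residue_mul_inv (Finset.range r) (fun i => -(l i : ℚ)) hx 1 (by
    intro i _ h
    have : (0 : ℚ) ≤ l i := Nat.cast_nonneg _
    linarith)
  have hz : ∏ j ∈ Finset.range r, (1 - ((1 : ℚ) - -(l j : ℚ))⁻¹) = 0 := by
    obtain ⟨i, hi, h⟩ := h0
    exact Finset.prod_eq_zero (Finset.mem_range.2 hi) (by simp [h])
  rw [hz, sub_zero] at hp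
  calc ∑ k ∈ Finset.range r, frobenius r (Function.update l k (l k + 1))
      = ∑ k ∈ Finset.range r, frobenius r l *
          (residue (Finset.range r) (fun i => -(l i : ℚ)) k * (1 - -(l k : ℚ))⁻¹) := by
        refine Finset.sum_congr rfl fun k hk => ?_
        rw [frobenius_ratio (Finset.mem_range.1 hk) hl
          (fun i hi => Function.update_of_ne hi _ _), mul_assoc, Function.update_self]
        congr 1
        rw [mul_comm (residue _ _ _), residue]
        congr 1
        · rw [Nat.factorial_succ]
          have := (l k).factorial_ne_zero
          have h' : (1 : ℚ) - -(l k : ℚ) = l k + 1 := by ring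
          rw [h']
          push_cast
          field_simp
        · refine Finset.prod_congr rfl fun j hj => ?_
          have : (l k : ℚ) - l j ≠ 0 := sub_ne_zero.2 fun he =>
            Finset.ne_of_mem_erase hj (hl (Finset.mem_coe.2 (Finset.mem_of_mem_erase hj))
              (Finset.mem_coe.2 hk) (by exact_mod_cast he.symm))
          have h' : -(l k : ℚ) - -(l j : ℚ) = -((l k : ℚ) - l j) := by ring
          rw [h']
          push_cast
          field_simp
          ring
    _ = frobenius r l := by rw [← Finset.mul_sum, hp, mul_one]

/-- Lowering `l k` by one multiplies the Frobenius product by `l k` times the residue at `l k`; the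
first moment of the residues gives the total. Terms with `l k = 0` vanish on both sides. -/
theorem sum_frobenius_sub (r : ℕ) (l : ℕ → ℕ) (hl : Set.InjOn l (Finset.range r)) :
    ∑ k ∈ Finset.range r, (if l k = 0 then 0 else frobenius r (Function.update l k (l k - 1))) =
      (∑ i ∈ Finset.range r, (l i : ℚ) - r * (r - 1) / 2) * frobenius r l := by
  have hx : Set.InjOn (fun i => (l i : ℚ)) (Finset.range r) := by
    intro i hi j hj hij
    refine hl hi hj ?_
    simpa using hij
  have hp := two_mul_sum_residue_mul (Finset.range r) (fun i => (l i : ℚ)) hx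
  rw [Finset.card_range] at hp
  have hp' : ∑ i ∈ Finset.range r, (l i : ℚ) - r * (r - 1) / 2 =
      ∑ i ∈ Finset.range r, residue (Finset.range r) (fun i => (l i : ℚ)) i * l i := by
    linarith
  rw [hp', Finset.sum_mul]
  refine Finset.sum_congr rfl fun k hk => ?_
  rcases Nat.eq_zero_or_pos (l k) with h0 | h0
  · simp [h0]
  rw [if_neg h0.ne', frobenius_ratio (Finset.mem_range.1 hk) hl
    (fun i hi => Function.update_of_ne hi _ _), Function.update_self]
  have h1 : ((l k).factorial : ℚ) / ((l k - 1).factorial : ℚ) = l k := by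
    rw [← Nat.mul_factorial_pred h0.ne']
    have := (l k - 1).factorial_ne_zero
    push_cast
    field_simp
  have h2 : ∏ j ∈ (Finset.range r).erase k, ((((l k - 1 : ℕ) : ℚ) - l j) / ((l k : ℚ) - l j)) =
      residue (Finset.range r) (fun i => (l i : ℚ)) k := by
    refine Finset.prod_congr rfl fun j hj => ?_
    have : (l k : ℚ) - l j ≠ 0 := sub_ne_zero.2 fun he =>
      Finset.ne_of_mem_erase hj (hl (Finset.mem_coe.2 (Finset.mem_of_mem_erase hj))
        (Finset.mem_coe.2 hk) (by exact_mod_cast he.symm))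
    rw [Nat.cast_sub h0]
    push_cast
    field_simp
    ring
  rw [h1, h2]
  ring

end Frobenius

/-! ### Hook lengths and the Frobenius product -/

section Hooks

variable (μ : YoungDiagram)

/-- The product of the hook lengths of the boxes of a Young diagram. -/
def diagramHookProduct : ℕ :=
  ∏ c ∈ μ.cells, ((μ.rowLen c.1 - (c.2 + 1)) + (μ.colLen c.2 - (c.1 + 1)) + 1)

/-- The row lengths, shifted so that they become strictly decreasing. -/
def shiftedRowLen (r i : ℕ) : ℕ := μ.rowLen i + (r - 1 - i)

theorem shiftedRowLen_lt {r i j : ℕ} (hij : i < j) (hj : j < r) :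
    shiftedRowLen μ r j < shiftedRowLen μ r i := by
  have := μ.rowLen_anti i j hij.le
  simp only [shiftedRowLen]
  omega

theorem injOn_shiftedRowLen (r : ℕ) : Set.InjOn (shiftedRowLen μ r) (Finset.range r) := by
  intro i hi j hj hij
  simp only [Finset.coe_range, Set.mem_Iio] at hi hj
  rcases lt_trichotomy i j with h | h | h
  · exact absurd hij (shiftedRowLen_lt μ h hj).ne'
  · exact h
  · exact absurd hij (shiftedRowLen_lt μ h hi).ne

theorem rowLen_eq_zero {i : ℕ} (h : μ.colLen 0 ≤ i) : μ.rowLen i = 0 := by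
  by_contra hne
  have := YoungDiagram.mem_iff_lt_rowLen.2 (Nat.pos_of_ne_zero hne)
  rw [YoungDiagram.mem_iff_lt_colLen] at this
  omega

/-- The hook lengths of row `i` and the differences of `l_i` with the later `l_j` are distinct
numbers between `1` and `l_i`. There are `l_i` of them in all, so together they are exactly `1, …,
l_i`. -/
theorem prod_row_hooks {r i : ℕ} (hr : μ.colLen 0 ≤ r) (hi : i < r) :
    (∏ c ∈ Finset.range (μ.rowLen i), ((μ.rowLen i - (c + 1)) + (μ.colLen c - (i + 1)) + 1)) *
      ∏ j ∈ Finset.Ioo i r, (shiftedRowLen μ r i - shiftedRowLen μ r j) =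
    (shiftedRowLen μ r i).factorial := by
  set h : ℕ → ℕ := fun c => (μ.rowLen i - (c + 1)) + (μ.colLen c - (i + 1)) + 1 with hh
  set d : ℕ → ℕ := fun j => shiftedRowLen μ r i - shiftedRowLen μ r j with hd
  have hcr : ∀ c j, c < μ.rowLen j ↔ j < μ.colLen c := fun c j => by
    rw [← YoungDiagram.mem_iff_lt_rowLen, YoungDiagram.mem_iff_lt_colLen]
  have hinjh : Set.InjOn h (Finset.range (μ.rowLen i)) := by
    intro c hc c' hc' he
    simp only [Finset.coe_range, Set.mem_Iio] at hc hc'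
    have h1 := (hcr c i).1 hc
    have h2 := (hcr c' i).1 hc'
    simp only [hh] at he
    rcases lt_trichotomy c c' with hlt | heq | hlt
    · have := μ.colLen_anti c c' hlt.le
      omega
    · exact heq
    · have := μ.colLen_anti c' c hlt.le
      omega
  have hinjd : Set.InjOn d (Finset.Ioo i r) := by
    intro j hj j' hj' he
    simp only [Finset.coe_Ioo, Set.mem_Ioo] at hj hj'
    have h1 := shiftedRowLen_lt μ hj.1 hj.2
    have h2 := shiftedRowLen_lt μ hj'.1 hj'.2
    refine injOn_shiftedRowLen μ r (by simpa using hj.2) (by simpa using hj'.2) ?_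
    simp only [hd] at he
    omega
  have hdisj : Disjoint ((Finset.range (μ.rowLen i)).image h) ((Finset.Ioo i r).image d) := by
    rw [Finset.disjoint_left]
    intro x hx hx'
    obtain ⟨c, hc, rfl⟩ := Finset.mem_image.1 hx
    obtain ⟨j, hj, he⟩ := Finset.mem_image.1 hx'
    rw [Finset.mem_range] at hc
    rw [Finset.mem_Ioo] at hj
    have h1 := (hcr c i).1 hc
    have h2 := hcr c j
    have h3 := shiftedRowLen_lt μ hj.1 hj.2
    simp only [hh, hd, shiftedRowLen] at he h3
    omega
  have hsub : (Finset.range (μ.rowLen i)).image h ∪ (Finset.Ioo i r).image d ⊆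
      Finset.Ico 1 (shiftedRowLen μ r i + 1) := by
    intro x hx
    rw [Finset.mem_Ico]
    rcases Finset.mem_union.1 hx with hx | hx
    · obtain ⟨c, hc, rfl⟩ := Finset.mem_image.1 hx
      rw [Finset.mem_range] at hc
      have h1 := (hcr c i).1 hc
      have h2 := μ.colLen_anti 0 c (Nat.zero_le c)
      simp only [hh, shiftedRowLen]
      omega
    · obtain ⟨j, hj, rfl⟩ := Finset.mem_image.1 hx
      rw [Finset.mem_Ioo] at hj
      have h3 := shiftedRowLen_lt μ hj.1 hj.2
      simp only [hd]
      omega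
  have heq := Finset.eq_of_subset_of_card_le hsub (by
    rw [Finset.card_union_of_disjoint hdisj, Finset.card_image_of_injOn hinjh,
      Finset.card_image_of_injOn hinjd]
    simp only [shiftedRowLen, Nat.card_Ico, Finset.card_range, Nat.card_Ioo]
    omega)
  rw [← Finset.prod_Ico_id_eq_factorial, ← heq, Finset.prod_union hdisj,
    Finset.prod_image hinjh, Finset.prod_image hinjd]

theorem inv_diagramHookProduct {r : ℕ} (hr : μ.colLen 0 ≤ r) :
    ((diagramHookProduct μ : ℚ))⁻¹ = frobenius r (shiftedRowLen μ r) := by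
  have h1 : diagramHookProduct μ = ∏ i ∈ Finset.range r, ∏ c ∈ Finset.range (μ.rowLen i),
      ((μ.rowLen i - (c + 1)) + (μ.colLen c - (i + 1)) + 1) := by
    rw [diagramHookProduct]
    refine Finset.prod_finset_product μ.cells _ _ fun p => ?_
    rw [YoungDiagram.mem_cells, ← Prod.mk.eta (p := p), YoungDiagram.mem_iff_lt_rowLen]
    simp only [Finset.mem_range]
    refine ⟨fun h => ⟨?_, h⟩, fun h => h.2⟩
    by_contra hlt
    rw [rowLen_eq_zero μ (hr.trans (not_lt.1 hlt))] at h
    omega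
  have h2 : ((∏ i ∈ Finset.range r, (shiftedRowLen μ r i).factorial : ℕ) : ℚ) =
      diagramHookProduct μ * ∏ i ∈ Finset.range r, ∏ j ∈ Finset.Ioo i r,
        ((shiftedRowLen μ r i : ℚ) - shiftedRowLen μ r j) := by
    rw [h1, Finset.prod_congr rfl fun i hi => (prod_row_hooks μ hr (Finset.mem_range.1 hi)).symm,
      Finset.prod_mul_distrib]
    push_cast
    congr 1
    refine Finset.prod_congr rfl fun i _ => Finset.prod_congr rfl fun j hj => ?_
    rw [Finset.mem_Ioo] at hj
    rw [Nat.cast_sub (shiftedRowLen_lt μ hj.1 hj.2).le]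
  have h3 : ((∏ i ∈ Finset.range r, (shiftedRowLen μ r i).factorial : ℕ) : ℚ) ≠ 0 :=
    Nat.cast_ne_zero.2 (Finset.prod_ne_zero_iff.2 fun i _ => Nat.factorial_ne_zero _)
  rw [frobenius, ← Nat.cast_prod, h2]
  rw [h2] at h3
  have h4 := left_ne_zero_of_mul h3
  have h5 := right_ne_zero_of_mul h3
  field_simp

theorem diagramHookProduct_pos : 0 < diagramHookProduct μ :=
  Finset.prod_pos fun _ _ => Nat.succ_pos _

theorem sum_shiftedRowLen {r : ℕ} (hr : μ.colLen 0 ≤ r) :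
    ∑ i ∈ Finset.range r, (shiftedRowLen μ r i : ℚ) - r * (r - 1) / 2 = μ.card := by
  have h1 : μ.card = ∑ i ∈ Finset.range r, μ.rowLen i := by
    have h : μ.card = ∑ c ∈ μ.cells, 1 := by simp [YoungDiagram.card]
    rw [h, Finset.sum_finset_product μ.cells (Finset.range r)
      (fun i => Finset.range (μ.rowLen i))]
    · simp
    intro p
    rw [YoungDiagram.mem_cells, ← Prod.mk.eta (p := p), YoungDiagram.mem_iff_lt_rowLen]
    simp only [Finset.mem_range]
    refine ⟨fun h => ⟨?_, h⟩, fun h => h.2⟩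
    by_contra hlt
    rw [rowLen_eq_zero μ (hr.trans (not_lt.1 hlt))] at h
    omega
  have h2 : ∑ i ∈ Finset.range r, ((r - 1 - i : ℕ) : ℚ) = r * (r - 1) / 2 := by
    rw [← Nat.cast_sum, Finset.sum_range_reflect (fun i => i) r]
    have := Finset.sum_range_id_mul_two r
    rcases Nat.eq_zero_or_pos r with rfl | h0
    · simp
    have h : ((∑ i ∈ Finset.range r, i : ℕ) : ℚ) * 2 = r * (r - 1) := by
      rw [← Nat.cast_two, ← Nat.cast_mul, this, Nat.cast_mul, Nat.cast_sub h0]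
      simp
    linarith
  simp only [shiftedRowLen, Nat.cast_add, Finset.sum_add_distrib, h2]
  rw [h1]
  push_cast
  ring

end Hooks

/-! ### Branching of tableaux and the hook length formula -/

namespace StandardTableau

theorem colLen_zero_le {n : ℕ} (Θ : StandardTableau n) : Θ.shape.colLen 0 ≤ n := by
  rw [YoungDiagram.colLen_eq_card]
  exact (Finset.card_le_card (Finset.filter_subset _ _)).trans Θ.card_shape.le

/-- The tableau obtained by putting the next number into a further box. -/
def extend {n : ℕ} (Θ : StandardTableau n) (μ : YoungDiagram) (c : ℕ × ℕ) (hc : c ∉ Θ.shape)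
    (hμ : ∀ d, d ∈ μ ↔ d = c ∨ d ∈ Θ.shape) : StandardTableau (n + 1) where
  shape := μ
  pos := Fin.snoc (α := fun _ => ℕ × ℕ) Θ.pos c
  pos_injective := by
    have h : ∀ k, Θ.pos k ≠ c := fun k hk => hc ((Θ.mem_shape_iff c).2 ⟨k, hk⟩)
    intro k l
    refine Fin.lastCases ?_ (fun k => ?_) k <;> refine Fin.lastCases ?_ (fun l => ?_) l
    · simp
    · simpa using fun hkl => absurd hkl.symm (h l)
    · simpa using fun hkl => absurd hkl (h k)
    · simpa using fun hkl => Θ.pos_injective hkl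
  mem_shape_iff d := by
    rw [hμ, Θ.mem_shape_iff]
    constructor
    · rintro (rfl | ⟨k, rfl⟩)
      · exact ⟨Fin.last n, by simp⟩
      · exact ⟨k.castSucc, by simp⟩
    · rintro ⟨k, rfl⟩
      induction k using Fin.lastCases with
      | last => simp
      | cast k => exact Or.inr ⟨k, by simp⟩
  row_increasing k l := by
    refine Fin.lastCases ?_ (fun k => ?_) k <;> refine Fin.lastCases ?_ (fun l => ?_) l
    · simp
    · simp only [Fin.snoc_last, Fin.snoc_castSucc]
      intro h1 h2
      refine absurd (Θ.shape.up_left_mem h1.le h2.le ?_) hc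
      exact (Θ.mem_shape_iff _).2 ⟨l, rfl⟩
    · exact fun _ _ => Fin.castSucc_lt_last k
    · simp only [Fin.snoc_castSucc, Fin.castSucc_lt_castSucc_iff]
      exact Θ.row_increasing k l
  col_increasing k l := by
    refine Fin.lastCases ?_ (fun k => ?_) k <;> refine Fin.lastCases ?_ (fun l => ?_) l
    · simp
    · simp only [Fin.snoc_last, Fin.snoc_castSucc]
      intro h1 h2
      refine absurd (Θ.shape.up_left_mem h2.le h1.le ?_) hc
      exact (Θ.mem_shape_iff _).2 ⟨l, rfl⟩
    · exact fun _ _ => Fin.castSucc_lt_last k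
    · simp only [Fin.snoc_castSucc, Fin.castSucc_lt_castSucc_iff]
      exact Θ.col_increasing k l

theorem removeLast_extend {n : ℕ} (Θ : StandardTableau n) (μ : YoungDiagram) (c : ℕ × ℕ)
    (hc : c ∉ Θ.shape) (hμ : ∀ d, d ∈ μ ↔ d = c ∨ d ∈ Θ.shape) :
    (Θ.extend μ c hc hμ).removeLast = Θ :=
  ext_pos (by funext k; simp [removeLast, extend])

theorem extend_pos_last {n : ℕ} (Θ : StandardTableau n) (μ : YoungDiagram) (c : ℕ × ℕ)
    (hc : c ∉ Θ.shape) (hμ : ∀ d, d ∈ μ ↔ d = c ∨ d ∈ Θ.shape) :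
    (Θ.extend μ c hc hμ).pos (Fin.last n) = c := by
  simp [extend]

theorem eq_of_removeLast_eq {n : ℕ} {Θ Φ : StandardTableau (n + 1)}
    (h : Θ.removeLast = Φ.removeLast) (hl : Θ.pos (Fin.last n) = Φ.pos (Fin.last n)) : Θ = Φ := by
  refine ext_pos (funext fun k => ?_)
  induction k using Fin.lastCases with
  | last => exact hl
  | cast k => exact congrArg (fun Ψ : StandardTableau n => Ψ.pos k) h

theorem rowLen_removeLast {n : ℕ} (Θ : StandardTableau (n + 1)) :
    Θ.shape.rowLen = Function.update Θ.removeLast.shape.rowLen (Θ.pos (Fin.last n)).1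
      (Θ.removeLast.shape.rowLen (Θ.pos (Fin.last n)).1 + 1) := by
  have h : ∀ i, Θ.shape.rowLen i = Θ.removeLast.shape.rowLen i +
      if (Θ.pos (Fin.last n)).1 = i then 1 else 0 := by
    intro i
    rw [rowLen_eq_card_filter, rowLen_eq_card_filter, Finset.card_filter, Finset.card_filter,
      Fin.sum_univ_castSucc]
    rfl
  funext i
  rw [h]
  by_cases hi : i = (Θ.pos (Fin.last n)).1
  · subst hi; simp
  · rw [Function.update_of_ne hi, if_neg (Ne.symm hi), add_zero]

theorem pos_last_notMem {n : ℕ} (Θ : StandardTableau (n + 1)) :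
    Θ.pos (Fin.last n) ∉ Θ.removeLast.shape := by
  simp [removeLast, YoungDiagram.mem_mk]

theorem pos_last_snd {n : ℕ} (Θ : StandardTableau (n + 1)) :
    (Θ.pos (Fin.last n)).2 = Θ.removeLast.shape.rowLen (Θ.pos (Fin.last n)).1 := by
  have h1 : (Θ.pos (Fin.last n)) ∈ Θ.shape := (Θ.mem_shape_iff _).2 ⟨_, rfl⟩
  have h2 := Θ.pos_last_notMem
  rw [← Prod.mk.eta (p := Θ.pos (Fin.last n)), YoungDiagram.mem_iff_lt_rowLen] at h1 h2
  rw [rowLen_removeLast, Function.update_self] at h1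
  omega

theorem shiftedRowLen_removeLast {n : ℕ} (Θ : StandardTableau (n + 1)) (r : ℕ) :
    shiftedRowLen Θ.shape r = Function.update (shiftedRowLen Θ.removeLast.shape r)
      (Θ.pos (Fin.last n)).1 (shiftedRowLen Θ.removeLast.shape r (Θ.pos (Fin.last n)).1 + 1) := by
  funext i
  rw [shiftedRowLen, rowLen_removeLast]
  by_cases hi : i = (Θ.pos (Fin.last n)).1
  · subst hi
    rw [Function.update_self, Function.update_self, shiftedRowLen]
    ring
  · rw [Function.update_of_ne hi, Function.update_of_ne hi, shiftedRowLen]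

theorem exists_extend {n : ℕ} (Θ : StandardTableau n) {k : ℕ}
    (hk : ∀ j < k, Θ.shape.rowLen k < Θ.shape.rowLen j) :
    ∃ Φ : StandardTableau (n + 1), Φ.removeLast = Θ ∧ (Φ.pos (Fin.last n)).1 = k := by
  have hc : (k, Θ.shape.rowLen k) ∉ Θ.shape := by
    rw [YoungDiagram.mem_iff_lt_rowLen]
    exact lt_irrefl _
  let μ : YoungDiagram := ⟨insert (k, Θ.shape.rowLen k) Θ.shape.cells, by
    rintro ⟨i, j⟩ ⟨i', j'⟩ hle hmem
    simp only [Finset.coe_insert, Set.mem_insert_iff, Prod.mk.injEq, Finset.mem_coe,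
      YoungDiagram.mem_cells] at hmem ⊢
    rw [Prod.mk_le_mk] at hle
    rcases hmem with ⟨rfl, rfl⟩ | hmem
    · rw [YoungDiagram.mem_iff_lt_rowLen]
      rcases lt_or_eq_of_le hle.1 with h | rfl
      · exact Or.inr (lt_of_le_of_lt hle.2 (hk _ h))
      · rcases lt_or_eq_of_le hle.2 with h | rfl
        · exact Or.inr h
        · exact Or.inl ⟨rfl, rfl⟩
    · exact Or.inr (Θ.shape.up_left_mem hle.1 hle.2 hmem)⟩
  have hμ : ∀ d, d ∈ μ ↔ d = (k, Θ.shape.rowLen k) ∨ d ∈ Θ.shape := by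
    intro d
    have h : d ∈ μ ↔ d ∈ insert (k, Θ.shape.rowLen k) Θ.shape.cells := Iff.rfl
    rw [h, Finset.mem_insert, YoungDiagram.mem_cells]
  exact ⟨Θ.extend μ _ hc hμ, Θ.removeLast_extend μ _ hc hμ, by rw [extend_pos_last]⟩

theorem inv_hookProduct {n : ℕ} (Θ : StandardTableau n) {r : ℕ} (hr : n ≤ r) :
    (Θ.hookProduct : ℚ)⁻¹ = frobenius r (shiftedRowLen Θ.shape r) :=
  inv_diagramHookProduct Θ.shape (Θ.colLen_zero_le.trans hr)

/-- A tableau above `Θ` is determined by the row that receives the new box, so the sum becomes that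
of `sum_frobenius_add`, provided that the rows which cannot take a box contribute zero. -/
theorem sum_inv_hookProduct_fiber {n : ℕ} (Θ : StandardTableau n) :
    ∑ Φ : StandardTableau (n + 1) with Φ.removeLast = Θ, (Φ.hookProduct : ℚ)⁻¹ =
      (Θ.hookProduct : ℚ)⁻¹ := by
  set l := shiftedRowLen Θ.shape (n + 1) with hl
  have h1 : ∀ Φ ∈ Finset.univ.filter fun Φ : StandardTableau (n + 1) => Φ.removeLast = Θ,
      (Φ.hookProduct : ℚ)⁻¹ = frobenius (n + 1) (Function.update l (Φ.pos (Fin.last n)).1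
        (l (Φ.pos (Fin.last n)).1 + 1)) := by
    intro Φ hΦ
    rw [Finset.mem_filter] at hΦ
    rw [inv_hookProduct Φ le_rfl, shiftedRowLen_removeLast, hΦ.2]
  rw [Finset.sum_congr rfl h1, inv_hookProduct Θ (Nat.le_succ n), ← hl,
    ← sum_frobenius_add (n + 1) l (injOn_shiftedRowLen _ _)]
  · rw [← Finset.sum_image (s := Finset.univ.filter fun Φ : StandardTableau (n + 1) =>
      Φ.removeLast = Θ) (g := fun Φ => (Φ.pos (Fin.last n)).1)
      (f := fun k => frobenius (n + 1) (Function.update l k (l k + 1)))]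
    · refine Finset.sum_subset ?_ ?_
      · intro k hk
        obtain ⟨Φ, _, rfl⟩ := Finset.mem_image.1 hk
        exact Finset.mem_range.2 (Φ.pos_lt _).1
      · intro k hk hk'
        by_cases hadd : ∀ j < k, Θ.shape.rowLen k < Θ.shape.rowLen j
        · obtain ⟨Φ, hΦ, hΦk⟩ := Θ.exists_extend hadd
          exact absurd (Finset.mem_image.2 ⟨Φ, by simp [hΦ], hΦk⟩) hk'
        · rw [Finset.mem_range] at hk
          rw [frobenius_ratio hk (injOn_shiftedRowLen _ _)
            (fun i hi => Function.update_of_ne hi _ _)]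
          -- Row `k` cannot take a box, so row `k - 1` has the same length. Raising `l k` makes it
          -- equal to `l (k - 1)`, and a factor of the Frobenius product vanishes.
          push Not at hadd
          obtain ⟨j, hj, hle⟩ := hadd
          have h2 := Θ.shape.rowLen_anti j (k - 1) (by omega)
          have h3 := Θ.shape.rowLen_anti (k - 1) k (by omega)
          have h4 : l (k - 1) = l k + 1 := by
            simp only [hl, shiftedRowLen]
            omega
          rw [Finset.prod_eq_zero (i := k - 1)]
          · rw [mul_zero]
          · rw [Finset.mem_erase, Finset.mem_range]
            omega
          · rw [Function.update_self, ← hl, h4, sub_self, zero_div]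
    · intro Φ hΦ Ψ hΨ h
      simp only [Finset.coe_filter, Finset.mem_univ, true_and, Set.mem_ofPred_eq] at hΦ hΨ
      refine eq_of_removeLast_eq (hΦ.trans hΨ.symm) (Prod.ext h ?_)
      rw [pos_last_snd, pos_last_snd, hΦ, hΨ]
      exact congrArg _ h
  -- With `n + 1` rows for `n` boxes the row with index `n` is empty and unshifted, which supplies
  -- the zero entry.
  · refine ⟨n, Nat.lt_succ_self n, ?_⟩
    rw [hl, shiftedRowLen, rowLen_eq_zero _ Θ.colLen_zero_le]
    omega

theorem hookProduct_pos {n : ℕ} (Θ : StandardTableau n) : 0 < Θ.hookProduct :=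
  diagramHookProduct_pos Θ.shape

/-- The empty tableau. -/
def empty : StandardTableau 0 where
  shape := ⊥
  pos := Fin.elim0
  pos_injective k := k.elim0
  mem_shape_iff c := by simp
  row_increasing k := k.elim0
  col_increasing k := k.elim0

theorem eq_empty (Θ : StandardTableau 0) : Θ = empty := ext_pos (funext fun k => k.elim0)

theorem hookProduct_zero (Θ : StandardTableau 0) : Θ.hookProduct = 1 := by
  rw [Θ.eq_empty]
  simp [hookProduct, empty]

theorem univ_zero : (Finset.univ : Finset (StandardTableau 0)) = {empty} :=
  Finset.eq_singleton_iff_unique_mem.2 ⟨Finset.mem_univ _, fun Θ _ => Θ.eq_empty⟩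

theorem sum_inv_hookProduct (n : ℕ) :
    ∑ Θ : StandardTableau n, (Θ.hookProduct : ℚ)⁻¹ = 1 := by
  induction n with
  | zero => rw [univ_zero, Finset.sum_singleton, hookProduct_zero]; simp
  | succ n ih =>
    rw [← ih, ← Finset.sum_fiberwise (s := Finset.univ) (g := removeLast)]
    exact Finset.sum_congr rfl fun Θ _ => Θ.sum_inv_hookProduct_fiber

open Classical in
-- The hook length formula. Sorting the tableaux by the row of the last box gives the recursion of
-- `sum_frobenius_sub`, whose factor is the number of boxes.
theorem card_filter_shape (n : ℕ) (μ : YoungDiagram) (hμ : μ.card = n) :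
    ((Finset.univ.filter fun Θ : StandardTableau n => Θ.shape = μ).card : ℚ) =
      n.factorial * (diagramHookProduct μ : ℚ)⁻¹ := by
  induction n generalizing μ with
  | zero =>
    have h : μ = ⊥ := by
      ext c
      rw [YoungDiagram.card, Finset.card_eq_zero] at hμ
      simp [hμ]
    subst h
    have h2 : (Finset.univ.filter fun Θ : StandardTableau 0 => Θ.shape = ⊥) = {empty} := by
      rw [univ_zero, Finset.filter_singleton]
      exact if_pos rfl
    rw [h2]
    simp [diagramHookProduct]
  | succ n ih =>
    -- One row more than `n + 1` boxes can occupy: the last row is empty with `l = 0`, so that its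
    -- term falls under the zero branch of `sum_frobenius_sub`.
    have hr : μ.colLen 0 ≤ n + 2 := by
      rw [YoungDiagram.colLen_eq_card]
      refine (Finset.card_le_card (Finset.filter_subset _ _)).trans ?_
      rw [YoungDiagram.card] at hμ
      omega
    have hr' : μ.rowLen (n + 1) = 0 := by
      refine rowLen_eq_zero μ ?_
      rw [YoungDiagram.colLen_eq_card]
      refine (Finset.card_le_card (Finset.filter_subset _ _)).trans ?_
      rw [YoungDiagram.card] at hμ
      omega
    set l := shiftedRowLen μ (n + 2) with hl
    have hsum := sum_frobenius_sub (n + 2) l (injOn_shiftedRowLen _ _)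
    rw [sum_shiftedRowLen μ hr, hμ] at hsum
    have hmaps : ∀ Θ ∈ Finset.univ.filter fun Θ : StandardTableau (n + 1) => Θ.shape = μ,
        (Θ.pos (Fin.last n)).1 ∈ Finset.range (n + 2) := fun Θ _ =>
      Finset.mem_range.2 ((Θ.pos_lt _).1.trans (Nat.lt_succ_self _))
    rw [inv_diagramHookProduct μ hr, ← hl, Nat.factorial_succ, mul_comm (n + 1), Nat.cast_mul,
      mul_assoc, ← hsum, Finset.mul_sum, Finset.card_eq_sum_card_fiberwise hmaps, Nat.cast_sum]
    refine Finset.sum_congr rfl fun k hk => ?_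
    rw [Finset.filter_filter]
    by_cases hrem : μ.rowLen (k + 1) < μ.rowLen k
    · have hc : (k, μ.rowLen k - 1) ∈ μ := by
        rw [YoungDiagram.mem_iff_lt_rowLen]
        omega
      let ν : YoungDiagram := ⟨μ.cells.erase (k, μ.rowLen k - 1), by
        rintro ⟨i, j⟩ ⟨i', j'⟩ hle hmem
        simp only [Finset.coe_erase, Set.mem_sdiff, Finset.mem_coe, YoungDiagram.mem_cells,
          Set.mem_singleton_iff, Prod.mk.injEq] at hmem ⊢
        rw [Prod.mk_le_mk] at hle
        refine ⟨μ.up_left_mem hle.1 hle.2 hmem.1, ?_⟩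
        rintro ⟨rfl, rfl⟩
        have h1 := YoungDiagram.mem_iff_lt_rowLen.1 hmem.1
        rcases lt_or_eq_of_le hle.1 with h | rfl
        · have h2 := μ.rowLen_anti _ _ (Nat.succ_le_of_lt h)
          simp only [Nat.succ_eq_add_one] at h2
          omega
        · exact hmem.2 ⟨rfl, by omega⟩⟩
      have hνcard : ν.card = n := by
        have h1 : ν.cells = μ.cells.erase (k, μ.rowLen k - 1) := rfl
        rw [YoungDiagram.card, h1, Finset.card_erase_of_mem hc]
        rw [YoungDiagram.card] at hμ
        omega
      have hmem : ∀ d, d ∈ ν ↔ d ≠ (k, μ.rowLen k - 1) ∧ d ∈ μ := by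
        intro d
        have h : d ∈ ν ↔ d ∈ μ.cells.erase (k, μ.rowLen k - 1) := Iff.rfl
        rw [h, Finset.mem_erase, YoungDiagram.mem_cells]
      have hν : ∀ d, d ∈ μ ↔ d = (k, μ.rowLen k - 1) ∨ d ∈ ν := by
        intro d
        rw [hmem]
        constructor
        · intro hd
          by_cases h : d = (k, μ.rowLen k - 1)
          · exact Or.inl h
          · exact Or.inr ⟨h, hd⟩
        · rintro (rfl | h)
          · exact hc
          · exact h.2
      have hnc : (k, μ.rowLen k - 1) ∉ ν := by simp [hmem]
      have hlast : ∀ Θ : StandardTableau (n + 1), Θ.shape = μ → (Θ.pos (Fin.last n)).1 = k →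
          Θ.pos (Fin.last n) = (k, μ.rowLen k - 1) := by
        intro Θ h1 h2
        refine Prod.ext h2 ?_
        rw [pos_last_snd, h2, ← h1, rowLen_removeLast, h2, Function.update_self]
        rfl
      have hshape : ∀ Θ : StandardTableau (n + 1), Θ.shape = μ → (Θ.pos (Fin.last n)).1 = k →
          Θ.removeLast.shape = ν := by
        intro Θ h1 h2
        ext d
        simp only [removeLast, ν]
        rw [hlast Θ h1 h2, h1]
      have hex : ∀ Φ : StandardTableau n, Φ.shape = ν → ∃ Θ : StandardTableau (n + 1),
          Θ.shape = μ ∧ (Θ.pos (Fin.last n)).1 = k ∧ Θ.removeLast = Φ := by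
        rintro Φ rfl'
        refine ⟨Φ.extend μ (k, μ.rowLen k - 1) (by rw [rfl']; exact hnc)
          (fun d => by rw [rfl']; exact hν d), rfl, ?_, removeLast_extend ..⟩
        rw [extend_pos_last]
      have hcard : (Finset.univ.filter fun Θ : StandardTableau (n + 1) =>
          Θ.shape = μ ∧ (Θ.pos (Fin.last n)).1 = k).card =
          (Finset.univ.filter fun Φ : StandardTableau n => Φ.shape = ν).card := by
        refine Finset.card_bij (fun Θ _ => Θ.removeLast) ?_ ?_ ?_
        · intro Θ hΘ
          simp only [Finset.mem_filter, Finset.mem_univ, true_and] at hΘ ⊢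
          exact hshape Θ hΘ.1 hΘ.2
        · intro Θ hΘ Θ' hΘ' h
          simp only [Finset.mem_filter, Finset.mem_univ, true_and] at hΘ hΘ'
          exact eq_of_removeLast_eq h ((hlast Θ hΘ.1 hΘ.2).trans (hlast Θ' hΘ'.1 hΘ'.2).symm)
        · intro Φ hΦ
          simp only [Finset.mem_filter, Finset.mem_univ, true_and] at hΦ
          obtain ⟨Θ, h1, h2, h3⟩ := hex Φ hΦ
          exact ⟨Θ, by simp [h1, h2], h3⟩
      have hlk : l k ≠ 0 := by
        simp only [hl, shiftedRowLen]
        omega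
      rw [hcard, ih ν hνcard, if_neg hlk]
      congr 1
      have hνr : ν.colLen 0 ≤ n + 2 := by
        rw [YoungDiagram.colLen_eq_card]
        refine (Finset.card_le_card (Finset.filter_subset _ _)).trans ?_
        rw [YoungDiagram.card] at hνcard
        omega
      rw [inv_diagramHookProduct ν hνr]
      congr 1
      have hrow : ∀ i, ν.rowLen i = if i = k then μ.rowLen k - 1 else μ.rowLen i := by
        intro i
        refine eq_of_forall_lt_iff fun j => ?_
        have h := hν (i, j)
        have h' := hnc
        rw [YoungDiagram.mem_iff_lt_rowLen, YoungDiagram.mem_iff_lt_rowLen, Prod.mk.injEq] at h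
        rw [YoungDiagram.mem_iff_lt_rowLen] at h'
        split_ifs with hik
        · subst hik
          simp only [true_and] at h
          omega
        · simp only [hik, false_and, false_or] at h
          exact h.symm
      funext i
      rw [shiftedRowLen, hrow]
      by_cases hik : i = k
      · subst hik
        rw [if_pos rfl, Function.update_self, hl, shiftedRowLen]
        omega
      · rw [if_neg hik, Function.update_of_ne hik, hl, shiftedRowLen]
    · have hempty : (Finset.univ.filter fun Θ : StandardTableau (n + 1) =>
          Θ.shape = μ ∧ (Θ.pos (Fin.last n)).1 = k) = ∅ := by
        rw [Finset.filter_eq_empty_iff]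
        rintro Θ - ⟨h1, h2⟩
        have h3 := Θ.rowLen_removeLast
        rw [h1, h2] at h3
        rw [h3, Function.update_self, Function.update_of_ne (by omega)] at hrem
        have h4 := Θ.removeLast.shape.rowLen_anti k (k + 1) (Nat.le_succ k)
        omega
      rw [hempty, Finset.card_empty, Nat.cast_zero, eq_comm]
      have h3 := μ.rowLen_anti k (k + 1) (Nat.le_succ k)
      rw [Finset.mem_range] at hk
      split_ifs with h0
      · simp
      -- No box can be removed from row `k`, so row `k + 1` is equally long; lowering `l k` makes it
      -- equal to `l (k + 1)` and the product vanishes. For the last row `l k = 0`, which is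
      -- excluded here.
      by_cases hk1 : k + 1 < n + 2
      · have h4 : l k - 1 = l (k + 1) := by
          simp only [hl, shiftedRowLen]
          omega
        rw [frobenius_ratio hk (injOn_shiftedRowLen _ _)
            (fun i hi => Function.update_of_ne hi _ _), Finset.prod_eq_zero (i := k + 1)]
        · simp
        · rw [Finset.mem_erase, Finset.mem_range]
          omega
        · rw [Function.update_self, ← hl, h4, sub_self, zero_div]
      · refine absurd ?_ h0
        obtain rfl : k = n + 1 := by omega
        rw [hl, shiftedRowLen, hr']
        omega

end StandardTableau

/-! ### The recursion along `S_n ⊂ S_{n+1}` -/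

open MonoidAlgebra

/-- The embedding of `S_n` into `S_{n+1}` as the stabilizer of the last point. -/
def extendPerm (n : ℕ) : Equiv.Perm (Fin n) →* Equiv.Perm (Fin (n + 1)) :=
  Equiv.Perm.viaEmbeddingHom Fin.castSuccEmb

theorem extendPerm_castSucc {n : ℕ} (σ : Equiv.Perm (Fin n)) (k : Fin n) :
    extendPerm n σ k.castSucc = (σ k).castSucc :=
  Equiv.Perm.viaEmbedding_apply σ Fin.castSuccEmb k

theorem extendPerm_last {n : ℕ} (σ : Equiv.Perm (Fin n)) :
    extendPerm n σ (Fin.last n) = Fin.last n := by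
  refine Equiv.Perm.viaEmbedding_apply_of_notMem σ Fin.castSuccEmb _ ?_
  rintro ⟨k, hk⟩
  exact (Fin.castSucc_lt_last k).ne hk

theorem sign_extendPerm {n : ℕ} (σ : Equiv.Perm (Fin n)) :
    Equiv.Perm.sign (extendPerm n σ) = Equiv.Perm.sign σ := by
  exact @Equiv.Perm.sign_extendDomain _ _ _ _ _ _ σ _
    (fun a => Classical.propDecidable _) (Equiv.ofInjective _ Fin.castSuccEmb.injective)

/-- The embedding of group algebras induced by `extendPerm`. -/
def extendAlg (n : ℕ) :
    MonoidAlgebra ℂ (Equiv.Perm (Fin n)) →ₐ[ℂ] MonoidAlgebra ℂ (Equiv.Perm (Fin (n + 1))) :=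
  MonoidAlgebra.mapDomainAlgHom ℂ ℂ (extendPerm n)

theorem extendAlg_single {n : ℕ} (σ : Equiv.Perm (Fin n)) (c : ℂ) :
    extendAlg n (single σ c) = single (extendPerm n σ) c := by
  simp [extendAlg]

theorem adj_extendAlg {n : ℕ} (x : MonoidAlgebra ℂ (Equiv.Perm (Fin n))) :
    adj (extendAlg n x) = extendAlg n (adj x) := by
  induction x using MonoidAlgebra.induction_linear with
  | zero => simp
  | add x y hx hy => simp [hx, hy]
  | single σ c => simp [extendAlg_single, adj_single]

namespace StandardTableau

theorem extendPerm_mem_rowPerms {n : ℕ} (Θ : StandardTableau (n + 1)) {σ : Equiv.Perm (Fin n)}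
    (hσ : σ ∈ Θ.removeLast.rowPerms) : extendPerm n σ ∈ Θ.rowPerms := by
  rw [mem_rowPerms] at hσ ⊢
  intro k
  induction k using Fin.lastCases with
  | last => rw [extendPerm_last]
  | cast k => rw [extendPerm_castSucc]; exact hσ k

theorem extendPerm_mem_colPerms {n : ℕ} (Θ : StandardTableau (n + 1)) {σ : Equiv.Perm (Fin n)}
    (hσ : σ ∈ Θ.removeLast.colPerms) : extendPerm n σ ∈ Θ.colPerms := by
  rw [mem_colPerms] at hσ ⊢
  intro k
  induction k using Fin.lastCases with
  | last => rw [extendPerm_last]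
  | cast k => rw [extendPerm_castSucc]; exact hσ k

theorem extendAlg_mul_rowSymmetrizer {n : ℕ} (Θ : StandardTableau (n + 1)) :
    extendAlg n Θ.removeLast.rowSymmetrizer * Θ.rowSymmetrizer =
      (Θ.removeLast.rowPerms.card : ℂ) • Θ.rowSymmetrizer := by
  rw [rowSymmetrizer, map_sum, Finset.sum_mul, Finset.sum_congr rfl fun σ hσ => by
    rw [extendAlg_single, Θ.single_mul_rowSymmetrizer (Θ.extendPerm_mem_rowPerms hσ)],
    Finset.sum_const, Nat.cast_smul_eq_nsmul]

theorem colAntisymmetrizer_mul_extendAlg {n : ℕ} (Θ : StandardTableau (n + 1)) :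
    Θ.colAntisymmetrizer * extendAlg n Θ.removeLast.colAntisymmetrizer =
      (Θ.removeLast.colPerms.card : ℂ) • Θ.colAntisymmetrizer := by
  have h : ∀ σ ∈ Θ.removeLast.colPerms, Θ.colAntisymmetrizer *
      extendAlg n (single σ ((Equiv.Perm.sign σ : ℤ) : ℂ)) = Θ.colAntisymmetrizer := by
    intro σ hσ
    rw [extendAlg_single, single_eq_smul, mul_smul_comm,
      Θ.colAntisymmetrizer_mul_single (Θ.extendPerm_mem_colPerms hσ), sign_extendPerm, smul_smul,
      ← Int.cast_mul, ← Units.val_mul, Int.units_mul_self]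
    simp
  rw [colAntisymmetrizer.eq_1 Θ.removeLast, map_sum, Finset.mul_sum, Finset.sum_congr rfl h,
    Finset.sum_const, Nat.cast_smul_eq_nsmul]

/-- The Hermitian Young operators as elements of the group algebra. -/
def proj : {n : ℕ} → StandardTableau n → MonoidAlgebra ℂ (Equiv.Perm (Fin n))
  | 0, _ => 1
  | n + 1, Θ => extendAlg n (proj Θ.removeLast) * Θ.young * extendAlg n (proj Θ.removeLast)

/-- The properties of the elements `proj Θ` that are established by induction on the number of
boxes. -/
structure ProjProperties (n : ℕ) : Prop where
  mul : ∀ Θ Φ : StandardTableau n, Θ.proj * Φ.proj = if Θ = Φ then Θ.proj else 0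
  sum : ∑ Θ : StandardTableau n, Θ.proj = 1
  adj_proj : ∀ Θ : StandardTableau n, adj Θ.proj = Θ.proj
  sandwich : ∀ Θ : StandardTableau n, Θ.colAntisymmetrizer * Θ.proj * Θ.rowSymmetrizer =
    Θ.colAntisymmetrizer * Θ.rowSymmetrizer

/-- The element `proj` of the tableau with the last box removed, embedded into the
group algebra of `S_{n+1}`. -/
def parentProj {n : ℕ} (Θ : StandardTableau (n + 1)) :
    MonoidAlgebra ℂ (Equiv.Perm (Fin (n + 1))) := extendAlg n Θ.removeLast.proj

/-- The element `proj Θ` with the normalization of the Young symmetrizer that makes it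
idempotent. -/
def normProj {n : ℕ} (Θ : StandardTableau (n + 1)) :
    MonoidAlgebra ℂ (Equiv.Perm (Fin (n + 1))) := Θ.parentProj * Θ.normYoung * Θ.parentProj

theorem ProjProperties.parentProj_mul {n : ℕ} (hn : ProjProperties n)
    (Θ Φ : StandardTableau (n + 1)) :
    Θ.parentProj * Φ.parentProj =
      if Θ.removeLast = Φ.removeLast then Θ.parentProj else 0 := by
  rw [parentProj, parentProj, ← map_mul, hn.mul]
  split_ifs <;> simp

theorem ProjProperties.isIdempotentElem_parentProj {n : ℕ} (hn : ProjProperties n)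
    (Θ : StandardTableau (n + 1)) :
    IsIdempotentElem Θ.parentProj := by
  rw [IsIdempotentElem, hn.parentProj_mul, if_pos rfl]

/-- The permutation groups of the parent lie in those of `Θ`, so, up to nonzero factors, the
parent's antisymmetrizer can be split off from `a` and its symmetrizer from `s`. The identity for
the parent then removes the projector between them. -/
theorem ProjProperties.parent_sandwich {n : ℕ} (hn : ProjProperties n)
    (Θ : StandardTableau (n + 1)) :
    Θ.colAntisymmetrizer * Θ.parentProj * Θ.rowSymmetrizer =
      Θ.colAntisymmetrizer * Θ.rowSymmetrizer := by
  have hr : (Θ.removeLast.rowPerms.card : ℂ) ≠ 0 :=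
    Nat.cast_ne_zero.2 (Finset.card_ne_zero_of_mem Θ.removeLast.one_mem_rowPerms)
  have hc : (Θ.removeLast.colPerms.card : ℂ) ≠ 0 :=
    Nat.cast_ne_zero.2 (Finset.card_ne_zero_of_mem Θ.removeLast.one_mem_colPerms)
  have key : ∀ x : MonoidAlgebra ℂ (Equiv.Perm (Fin (n + 1))),
      (Θ.removeLast.colPerms.card : ℂ) • (Θ.removeLast.rowPerms.card : ℂ) •
        (Θ.colAntisymmetrizer * x * Θ.rowSymmetrizer) = Θ.colAntisymmetrizer *
        (extendAlg n Θ.removeLast.colAntisymmetrizer * x *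
          extendAlg n Θ.removeLast.rowSymmetrizer) * Θ.rowSymmetrizer := by
    intro x
    calc _ = ((Θ.removeLast.colPerms.card : ℂ) • Θ.colAntisymmetrizer) * x *
        ((Θ.removeLast.rowPerms.card : ℂ) • Θ.rowSymmetrizer) := by
          rw [smul_mul_assoc, mul_smul_comm, smul_mul_assoc, smul_comm]
      _ = _ := by
          rw [← Θ.extendAlg_mul_rowSymmetrizer, ← Θ.colAntisymmetrizer_mul_extendAlg]
          simp only [mul_assoc]
  have h1 : extendAlg n Θ.removeLast.colAntisymmetrizer * Θ.parentProj *
      extendAlg n Θ.removeLast.rowSymmetrizer = extendAlg n Θ.removeLast.colAntisymmetrizer * 1 *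
        extendAlg n Θ.removeLast.rowSymmetrizer := by
    rw [parentProj, ← map_mul, ← map_mul, hn.sandwich, map_mul, mul_one]
  have h2 := (key Θ.parentProj).trans ((congrArg (fun y => Θ.colAntisymmetrizer * y *
    Θ.rowSymmetrizer) h1).trans (key 1).symm)
  rw [mul_one] at h2
  exact (IsUnit.mk0 _ hr).smul_left_cancel.1 ((IsUnit.mk0 _ hc).smul_left_cancel.1 h2)

theorem ProjProperties.normYoung_mul {n : ℕ} (hn : ProjProperties n)
    (Θ : StandardTableau (n + 1)) :
    Θ.normYoung * Θ.parentProj * Θ.normYoung = Θ.normYoung := by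
  have h : Θ.sym * Θ.parentProj * Θ.sym = Θ.sym * Θ.sym := by
    calc Θ.sym * Θ.parentProj * Θ.sym = Θ.rowSymmetrizer *
        (Θ.colAntisymmetrizer * Θ.parentProj * Θ.rowSymmetrizer) * Θ.colAntisymmetrizer := by
          simp only [sym, mul_assoc]
      _ = Θ.sym * Θ.sym := by rw [hn.parent_sandwich]; simp only [sym, mul_assoc]
  conv_rhs => rw [← Θ.isIdempotentElem_normYoung.eq]
  simp only [normYoung, smul_mul_assoc, mul_smul_comm, h]

theorem normYoung_mul_mul_of_shape_ne {n : ℕ} {Θ Φ : StandardTableau n} (h : Θ.shape ≠ Φ.shape)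
    (x : MonoidAlgebra ℂ (Equiv.Perm (Fin n))) : Θ.normYoung * x * Φ.normYoung = 0 := by
  simp only [normYoung, smul_mul_assoc, mul_smul_comm, sym_mul_mul_sym_of_shape_ne Θ Φ h, smul_zero]

/-- A common shape would place the last number of both tableaux in the only box missing from the
parent. -/
theorem shape_ne_of_removeLast_eq {n : ℕ} {Θ Φ : StandardTableau (n + 1)} (hne : Θ ≠ Φ)
    (h : Θ.removeLast = Φ.removeLast) : Θ.shape ≠ Φ.shape := by
  intro hs
  refine hne (eq_of_removeLast_eq h ?_)
  have h1 : Θ.pos (Fin.last n) ∈ Φ.shape := hs ▸ (Θ.mem_shape_iff _).2 ⟨_, rfl⟩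
  obtain ⟨k, hk⟩ := (Φ.mem_shape_iff _).1 h1
  induction k using Fin.lastCases with
  | last => exact hk.symm
  | cast k =>
    refine absurd ?_ Θ.pos_last_notMem
    rw [h, Φ.removeLast.mem_shape_iff]
    exact ⟨k, hk⟩

end StandardTableau

/-! ### The hook normalization and the inductive step -/

namespace StandardTableau

theorem exists_perm_of_shape_eq {n : ℕ} {Θ Φ : StandardTableau n} (h : Θ.shape = Φ.shape) :
    ∃ g : Equiv.Perm (Fin n), ∀ k, Φ.pos (g k) = Θ.pos k := by
  have h1 : ∀ k, ∃ l, Φ.pos l = Θ.pos k := fun k => by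
    rw [← Φ.mem_shape_iff, ← h, Θ.mem_shape_iff]
    exact ⟨k, rfl⟩
  choose u hu using h1
  have hinj : Function.Injective u := fun k l hkl => Θ.pos_injective (by rw [← hu, ← hu, hkl])
  exact ⟨Equiv.ofBijective u (Finite.injective_iff_bijective.1 hinj), hu⟩

theorem single_mul_sym {n : ℕ} {Θ Φ : StandardTableau n} {g : Equiv.Perm (Fin n)}
    (hg : ∀ k, Φ.pos (g k) = Θ.pos k) : single g 1 * Θ.sym = Φ.sym * single g 1 := by
  have hg' : ∀ k, Θ.pos (g⁻¹ k) = Φ.pos k := fun k => by rw [← hg]; simp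
  have h1 : single g 1 * Θ.rowSymmetrizer = Φ.rowSymmetrizer * single g 1 := by
    rw [rowSymmetrizer, rowSymmetrizer, Finset.mul_sum, Finset.sum_mul]
    refine Finset.sum_equiv (MulAut.conj g).toEquiv (fun σ => ?_) fun σ _ => ?_
    · simp only [mem_rowPerms, MulEquiv.toEquiv_eq_coe, MulEquiv.coe_toEquiv, MulAut.conj_apply,
        Equiv.Perm.mul_apply, hg]
      refine ⟨fun h k => ?_, fun h k => ?_⟩
      · rw [h, hg']
      · have := h (g k)
        rw [hg] at this
        simpa using this
    · simp [single_mul_single]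
  have h2 : single g 1 * Θ.colAntisymmetrizer = Φ.colAntisymmetrizer * single g 1 := by
    rw [colAntisymmetrizer, colAntisymmetrizer, Finset.mul_sum, Finset.sum_mul]
    refine Finset.sum_equiv (MulAut.conj g).toEquiv (fun σ => ?_) fun σ _ => ?_
    · simp only [mem_colPerms, MulEquiv.toEquiv_eq_coe, MulEquiv.coe_toEquiv, MulAut.conj_apply,
        Equiv.Perm.mul_apply, hg]
      refine ⟨fun h k => ?_, fun h k => ?_⟩
      · rw [h, hg']
      · have := h (g k)
        rw [hg] at this
        simpa using this
    · have : Equiv.Perm.sign (g * σ * g⁻¹) = Equiv.Perm.sign σ := by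
        rw [Equiv.Perm.sign_mul, Equiv.Perm.sign_mul, Equiv.Perm.sign_inv, mul_right_comm,
          Int.units_mul_self, one_mul]
      simp only [MulEquiv.toEquiv_eq_coe, MulEquiv.coe_toEquiv, MulAut.conj_apply, this,
        single_mul_single, one_mul, mul_one, inv_mul_cancel_right]
  rw [sym, sym, ← mul_assoc, h1, mul_assoc, h2, mul_assoc]

theorem ProjProperties.normProj_mul {n : ℕ} (hn : ProjProperties n)
    (Θ Φ : StandardTableau (n + 1)) :
    Θ.normProj * Φ.normProj = if Θ = Φ then Θ.normProj else 0 := by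
  have h0 : Θ.normProj * Φ.normProj = Θ.parentProj * Θ.normYoung *
      (Θ.parentProj * Φ.parentProj) * Φ.normYoung * Φ.parentProj := by
    simp only [normProj, mul_assoc]
  rw [h0, hn.parentProj_mul]
  split_ifs with h1 h2 h2
  · subst h2
    rw [mul_assoc Θ.parentProj Θ.normYoung, mul_assoc Θ.parentProj, hn.normYoung_mul, normProj]
  · rw [mul_assoc Θ.parentProj Θ.normYoung, mul_assoc Θ.parentProj,
      normYoung_mul_mul_of_shape_ne (shape_ne_of_removeLast_eq h2 h1), mul_zero, zero_mul]
  · exact absurd (congrArg removeLast h2) h1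
  · simp

theorem ProjProperties.parentProj_mul_normProj {n : ℕ} (hn : ProjProperties n)
    (Θ : StandardTableau (n + 1)) : Θ.parentProj * Θ.normProj = Θ.normProj := by
  rw [normProj, ← mul_assoc, ← mul_assoc, (hn.isIdempotentElem_parentProj Θ).eq]

/-- The coefficient at `1` is a trace: cyclicity turns `q Y q` into `Y q`, then, with `Y = Y Y`,
into `Y q Y = Y`. -/
theorem ProjProperties.unitCoeff_normProj {n : ℕ} (hn : ProjProperties n)
    (Θ : StandardTableau (n + 1)) : unitCoeff Θ.normProj = Θ.symConst⁻¹ := by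
  rw [normProj, mul_assoc, unitCoeff_mul_comm, mul_assoc, (hn.isIdempotentElem_parentProj Θ).eq]
  conv_lhs => rw [← Θ.isIdempotentElem_normYoung.eq]
  rw [mul_assoc, unitCoeff_mul_comm, hn.normYoung_mul, unitCoeff_normYoung]

theorem ProjProperties.normProj_ne_zero {n : ℕ} (hn : ProjProperties n)
    (Θ : StandardTableau (n + 1)) : Θ.normProj ≠ 0 := by
  intro h
  have := hn.unitCoeff_normProj Θ
  rw [h, map_zero] at this
  exact inv_ne_zero Θ.symConst_ne_zero this.symm

theorem ProjProperties.isIdempotentElem_one_sub_sum {n : ℕ} (hn : ProjProperties n) :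
    IsIdempotentElem (1 - ∑ Θ : StandardTableau (n + 1), Θ.normProj) := by
  refine IsIdempotentElem.one_sub ?_
  rw [IsIdempotentElem, Finset.sum_mul_sum]
  refine Finset.sum_congr rfl fun Θ _ => ?_
  rw [Finset.sum_congr rfl fun Φ _ => hn.normProj_mul Θ Φ]
  simp

/-- The dimension of the right ideal generated by the Young symmetrizer. -/
def idealDim {n : ℕ} (Θ : StandardTableau n) : ℕ :=
  Module.finrank ℂ (LinearMap.range (LinearMap.mulLeft ℂ Θ.normYoung))

theorem idealDim_eq {n : ℕ} (Θ : StandardTableau n) :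
    (Θ.idealDim : ℂ) = n.factorial * Θ.symConst⁻¹ := by
  rw [idealDim, ← card_mul_unitCoeff Θ.isIdempotentElem_normYoung, unitCoeff_normYoung,
    Fintype.card_perm, Fintype.card_fin]

/-- The rank of the idempotent `1 - ∑ normProj` is `(n + 1)!` minus the sum of the dimensions, and a
rank is not negative. -/
theorem ProjProperties.sum_idealDim_le {n : ℕ} (hn : ProjProperties n) :
    ∑ Θ : StandardTableau (n + 1), Θ.idealDim ≤ (n + 1).factorial := by
  have h := card_mul_unitCoeff hn.isIdempotentElem_one_sub_sum
  set d := Module.finrank ℂ (LinearMap.range (LinearMap.mulLeft ℂ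
    (1 - ∑ Θ : StandardTableau (n + 1), Θ.normProj)))
  rw [map_sub, map_sum, unitCoeff_one, Finset.sum_congr rfl fun Θ _ => hn.unitCoeff_normProj Θ,
    mul_sub, mul_one, Fintype.card_perm, Fintype.card_fin, Finset.mul_sum,
    Finset.sum_congr rfl fun Θ _ => (Θ.idealDim_eq).symm, sub_eq_iff_eq_add] at h
  have h2 : (n + 1).factorial = d + ∑ Θ : StandardTableau (n + 1), Θ.idealDim := by
    exact_mod_cast h
  omega

open Classical in
-- With `g` carrying `Θ` to `Φ`, the elements `Y_Φ g p_Θ` lie in the right ideal. Multiplying by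
-- `p_Ψ` on the right isolates one of them, so they are independent once they are nonzero. This
-- holds because `g` turns `Y_Φ` into `Y_Θ`, and `Y_Θ p_Θ = 0` would give `p_Θ = p_Θ p_Θ = 0`.
theorem ProjProperties.card_filter_shape_le {n : ℕ} (hn : ProjProperties n)
    (Φ : StandardTableau (n + 1)) :
    (Finset.univ.filter fun Θ : StandardTableau (n + 1) => Θ.shape = Φ.shape).card ≤
      Φ.idealDim := by
  have := finite_groupAlgebra (G := Equiv.Perm (Fin (n + 1)))
  have hg : ∀ Θ : {Θ : StandardTableau (n + 1) // Θ.shape = Φ.shape},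
      ∃ g : Equiv.Perm (Fin (n + 1)), ∀ k, Φ.pos (g k) = Θ.1.pos k := fun Θ =>
    exists_perm_of_shape_eq Θ.2
  choose g hg using hg
  let v : {Θ : StandardTableau (n + 1) // Θ.shape = Φ.shape} →
      LinearMap.range (LinearMap.mulLeft ℂ Φ.normYoung) := fun Θ =>
    ⟨Φ.normYoung * (single (g Θ) 1 * Θ.1.normProj), _, rfl⟩
  have hv0 : ∀ Θ, Φ.normYoung * (single (g Θ) 1 * Θ.1.normProj) ≠ 0 := by
    intro Θ h
    rw [normYoung, smul_mul_assoc, smul_eq_zero] at h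
    have h := h.resolve_left (inv_ne_zero Φ.symConst_ne_zero)
    rw [← mul_assoc, ← single_mul_sym (hg Θ)] at h
    have h' : Θ.1.sym * Θ.1.normProj = 0 := by
      have h2 := congrArg (fun y => single (g Θ)⁻¹ (1 : ℂ) * y) h
      simp only [← mul_assoc, single_mul_single, inv_mul_cancel, mul_one, mul_zero] at h2
      rwa [← MonoidAlgebra.one_def, one_mul] at h2
    refine hn.normProj_ne_zero Θ.1 ?_
    have h3 := hn.normProj_mul Θ.1 Θ.1
    rw [if_pos rfl] at h3
    rw [← h3]
    nth_rewrite 1 [normProj]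
    rw [mul_assoc, hn.parentProj_mul_normProj, mul_assoc, normYoung, smul_mul_assoc, h', smul_zero,
      mul_zero]
  have hlin : LinearIndependent ℂ v := by
    rw [Fintype.linearIndependent_iff]
    intro c hc Ψ
    have h1 : ∑ Θ, c Θ • (Φ.normYoung * (single (g Θ) 1 * Θ.1.normProj)) = 0 := by
      have := congrArg Subtype.val hc
      simpa [v] using this
    have h2 := congrArg (fun y => y * Ψ.1.normProj) h1
    simp only [zero_mul, Finset.sum_mul, smul_mul_assoc, mul_assoc, hn.normProj_mul] at h2
    rw [Finset.sum_eq_single Ψ] at h2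
    · rw [if_pos rfl, smul_eq_zero] at h2
      exact h2.resolve_right (hv0 Ψ)
    · intro Θ _ hΘ
      rw [if_neg fun h => hΘ (Subtype.ext h)]
      simp
    · simp
  have := hlin.fintype_card_le_finrank
  rwa [Fintype.card_subtype] at this

/-- The hook length normalization makes the Young symmetrizer idempotent. -/
theorem ProjProperties.symConst_eq {n : ℕ} (hn : ProjProperties n) (Θ : StandardTableau (n + 1)) :
    Θ.symConst = Θ.hookProduct := by
  classical
  let f : StandardTableau (n + 1) → ℕ := fun Φ =>
    (Finset.univ.filter fun Θ : StandardTableau (n + 1) => Θ.shape = Φ.shape).card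
  have hf : ∀ Φ : StandardTableau (n + 1),
      (f Φ : ℚ) = (n + 1).factorial * (Φ.hookProduct : ℚ)⁻¹ := fun Φ =>
    card_filter_shape (n + 1) Φ.shape Φ.card_shape
  have hsum : ∑ Φ, f Φ = (n + 1).factorial := by
    have : ((∑ Φ, f Φ : ℕ) : ℚ) = (n + 1).factorial := by
      rw [Nat.cast_sum, Finset.sum_congr rfl fun Φ _ => hf Φ, ← Finset.mul_sum,
        sum_inv_hookProduct, mul_one]
    exact_mod_cast this
  have hle : ∀ Φ ∈ Finset.univ, f Φ ≤ idealDim Φ := fun Φ _ => hn.card_filter_shape_le Φ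
  -- Termwise the tableau counts are at most the dimensions, but they already sum to `(n + 1)!`,
  -- which bounds the sum of the dimensions; so each inequality is an equality.
  have heq := (Finset.sum_eq_sum_iff_of_le hle).1
    (le_antisymm (Finset.sum_le_sum hle) (hn.sum_idealDim_le.trans hsum.ge)) Θ (Finset.mem_univ Θ)
  have h1 := Θ.idealDim_eq
  have h2 : (f Θ : ℂ) = (n + 1).factorial * (Θ.hookProduct : ℂ)⁻¹ := by
    have := congrArg (fun q : ℚ => (q : ℂ)) (hf Θ)
    push_cast at this
    exact this
  rw [← heq, h2] at h1
  have h3 : (((n + 1).factorial : ℕ) : ℂ) ≠ 0 := Nat.cast_ne_zero.2 (Nat.factorial_ne_zero _)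
  exact (inv_injective (mul_left_cancel₀ h3 h1)).symm

theorem ProjProperties.young_eq {n : ℕ} (hn : ProjProperties n) (Θ : StandardTableau (n + 1)) :
    Θ.young = Θ.normYoung := by
  rw [young, normYoung, hn.symConst_eq]
  rfl

theorem ProjProperties.proj_eq {n : ℕ} (hn : ProjProperties n) (Θ : StandardTableau (n + 1)) :
    Θ.proj = Θ.normProj := by
  rw [proj, hn.young_eq]
  rfl

theorem adj_sym {n : ℕ} (Θ : StandardTableau n) :
    adj Θ.sym = Θ.colAntisymmetrizer * Θ.rowSymmetrizer := by
  rw [sym, adj_mul, adj_rowSymmetrizer, adj_colAntisymmetrizer]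

/-- Up to a nonzero factor `a s` equals its cube, and `(a s)³ = a (s a)(s a) s` contains `sym Θ` to
the left of `x * Φ.sym`, where the vanishing for different shapes applies. -/
theorem adj_sym_mul_mul_sym_of_shape_ne {n : ℕ} {Θ Φ : StandardTableau n}
    (h : Θ.shape ≠ Φ.shape) (x : MonoidAlgebra ℂ (Equiv.Perm (Fin n))) :
    adj Θ.sym * x * Φ.sym = 0 := by
  have h1 : adj Θ.sym * adj Θ.sym * adj Θ.sym =
      (starRingEnd ℂ Θ.symConst * starRingEnd ℂ Θ.symConst) • adj Θ.sym := by
    rw [← adj_mul, sym_mul_sym, adj_smul, smul_mul_assoc, ← adj_mul, sym_mul_sym, adj_smul,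
      smul_smul]
  have h2 : adj Θ.sym * adj Θ.sym * adj Θ.sym =
      Θ.colAntisymmetrizer * Θ.sym * Θ.sym * Θ.rowSymmetrizer := by
    rw [adj_sym, sym]
    simp only [mul_assoc]
  have h3 : (starRingEnd ℂ Θ.symConst * starRingEnd ℂ Θ.symConst) • (adj Θ.sym * x * Φ.sym) =
      0 := by
    rw [← smul_mul_assoc, ← smul_mul_assoc, ← h1, h2]
    calc _ = Θ.colAntisymmetrizer * Θ.sym * (Θ.sym * (Θ.rowSymmetrizer * x) * Φ.sym) := by
          simp only [mul_assoc]
      _ = 0 := by rw [sym_mul_mul_sym_of_shape_ne Θ Φ h, mul_zero]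
  refine (smul_eq_zero.1 h3).resolve_left (mul_ne_zero ?_ ?_) <;>
    exact (map_ne_zero _).2 Θ.symConst_ne_zero

theorem ProjProperties.succ {n : ℕ} (hn : ProjProperties n) : ProjProperties (n + 1) := by
  have hsum : ∑ Θ : StandardTableau (n + 1), Θ.proj = 1 := by
    rw [Finset.sum_congr rfl fun Θ _ => hn.proj_eq Θ, eq_comm, ← sub_eq_zero]
    -- The difference is idempotent with coefficient `1 - ∑ 1/|Θ| = 0`.
    refine eq_zero_of_unitCoeff_eq_zero hn.isIdempotentElem_one_sub_sum ?_
    rw [map_sub, map_sum, unitCoeff_one, Finset.sum_congr rfl fun Θ _ => hn.unitCoeff_normProj Θ,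
      Finset.sum_congr rfl fun Θ _ => by rw [hn.symConst_eq Θ], sub_eq_zero]
    have := congrArg (fun q : ℚ => (q : ℂ)) (sum_inv_hookProduct (n + 1))
    push_cast at this
    exact this.symm
  have hparent : ∀ Θ : StandardTableau (n + 1), adj Θ.parentProj = Θ.parentProj := fun Θ => by
    rw [parentProj, adj_extendAlg, hn.adj_proj]
  have hzero : ∀ Θ Φ : StandardTableau (n + 1), Φ ≠ Θ → adj Φ.normProj * Θ.normProj = 0 := by
    intro Θ Φ hne
    have h0 : adj Φ.normProj * Θ.normProj = Φ.parentProj * adj Φ.normYoung *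
        (Φ.parentProj * Θ.parentProj) * Θ.normYoung * Θ.parentProj := by
      simp only [normProj, adj_mul, hparent, mul_assoc]
    rw [h0, hn.parentProj_mul]
    split_ifs with h
    · have h1 : adj Φ.normYoung * Φ.parentProj * Θ.normYoung = 0 := by
        rw [normYoung, normYoung, adj_smul, smul_mul_assoc, smul_mul_assoc, mul_smul_comm,
          adj_sym_mul_mul_sym_of_shape_ne (shape_ne_of_removeLast_eq hne h), smul_zero, smul_zero]
      rw [mul_assoc Φ.parentProj (adj _), mul_assoc Φ.parentProj, h1, mul_zero, zero_mul]
    · simp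
  refine ⟨fun Θ Φ => ?_, hsum, fun Θ => ?_, fun Θ => ?_⟩
  · rw [hn.proj_eq, hn.proj_eq]
    exact hn.normProj_mul Θ Φ
  -- Multiply the adjoint of the completeness relation by `Θ.proj`; all terms but one vanish, and
  -- what remains is visibly self-adjoint.
  · have h1 : Θ.proj = adj Θ.proj * Θ.proj := by
      have h2 := congrArg (fun y => adj y * Θ.proj) hsum
      simp only [adj_one, one_mul, map_sum, Finset.sum_mul] at h2
      rw [Finset.sum_eq_single Θ] at h2
      · exact h2.symm
      · intro Φ _ hΦ
        rw [hn.proj_eq, hn.proj_eq]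
        exact hzero Θ Φ hΦ
      · simp
    rw [h1, adj_mul, adj_adj]
  -- `a q Y q s` is `(a q s)(a q s)` divided by the hook product, hence `(a s)(a s)` divided by it,
  -- which is `a s`.
  · have h1 : adj Θ.sym * adj Θ.sym = (Θ.hookProduct : ℂ) • adj Θ.sym := by
      rw [← adj_mul, sym_mul_sym, adj_smul, hn.symConst_eq, map_natCast]
    have h2 : (Θ.hookProduct : ℂ) ≠ 0 := Nat.cast_ne_zero.2 Θ.hookProduct_pos.ne'
    calc Θ.colAntisymmetrizer * Θ.proj * Θ.rowSymmetrizer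
        = (Θ.hookProduct : ℂ)⁻¹ • ((Θ.colAntisymmetrizer * Θ.parentProj * Θ.rowSymmetrizer) *
          (Θ.colAntisymmetrizer * Θ.parentProj * Θ.rowSymmetrizer)) := by
          simp only [hn.proj_eq, normProj, normYoung, hn.symConst_eq, sym, mul_assoc,
            smul_mul_assoc, mul_smul_comm]
      _ = Θ.colAntisymmetrizer * Θ.rowSymmetrizer := by
          rw [hn.parent_sandwich, ← adj_sym, h1, smul_smul, inv_mul_cancel₀ h2, one_smul]

theorem projProperties_zero : ProjProperties 0 := by
  refine ⟨fun Θ Φ => ?_, ?_, fun Θ => ?_, fun Θ => ?_⟩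
  · rw [Θ.eq_empty, Φ.eq_empty, if_pos rfl]
    simp [proj]
  · rw [univ_zero, Finset.sum_singleton]
    rfl
  · exact adj_one
  · simp [proj]

theorem projProperties (n : ℕ) : ProjProperties n := by
  induction n with
  | zero => exact projProperties_zero
  | succ n ih => exact ih.succ

theorem young_mul_young {n : ℕ} (Θ : StandardTableau (n + 1)) : Θ.young * Θ.young = Θ.young := by
  rw [(projProperties n).young_eq]
  exact Θ.isIdempotentElem_normYoung

theorem young_mul_parentProj_mul_young {n : ℕ} (Θ : StandardTableau (n + 1)) :
    Θ.young * Θ.parentProj * Θ.young = Θ.young := by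
  rw [(projProperties n).young_eq]
  exact (projProperties n).normYoung_mul Θ

theorem proj_succ {n : ℕ} (Θ : StandardTableau (n + 1)) :
    Θ.proj = Θ.parentProj * Θ.young * Θ.parentProj := rfl

/-- Primitivity: inside `q Y (q x q) Y q` the middle part is a multiple of `Y` by von Neumann's
lemma. This is the source of irreducibility. -/
theorem proj_mul_mul_proj {n : ℕ} (Θ : StandardTableau (n + 1))
    (x : MonoidAlgebra ℂ (Equiv.Perm (Fin (n + 1)))) :
    ∃ c : ℂ, Θ.proj * x * Θ.proj = c • Θ.proj := by
  obtain ⟨c, hc⟩ := Θ.sym_mul_mul_sym (Θ.parentProj * x * Θ.parentProj)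
  refine ⟨Θ.symConst⁻¹ * c, ?_⟩
  rw [(projProperties n).proj_eq]
  calc Θ.normProj * x * Θ.normProj = (Θ.symConst⁻¹ * Θ.symConst⁻¹) • (Θ.parentProj *
      (Θ.sym * (Θ.parentProj * x * Θ.parentProj) * Θ.sym) * Θ.parentProj) := by
        simp only [normProj, normYoung, mul_assoc, smul_mul_assoc, mul_smul_comm, smul_smul]
    _ = (Θ.symConst⁻¹ * c) • Θ.normProj := by
        rw [hc]
        simp only [normProj, normYoung, mul_assoc, smul_mul_assoc, mul_smul_comm, smul_smul]
        congr 1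
        ring

theorem proj_ne_zero {n : ℕ} (Θ : StandardTableau (n + 1)) : Θ.proj ≠ 0 := by
  rw [(projProperties n).proj_eq]
  exact (projProperties n).normProj_ne_zero Θ

theorem proj_one (Θ : StandardTableau 1) : Θ.proj = 1 := by
  have h1 : ∀ x : MonoidAlgebra ℂ (Equiv.Perm (Fin 1)), x = unitCoeff x • 1 := by
    intro x
    refine MonoidAlgebra.ext (Finsupp.ext fun g => ?_)
    rw [Subsingleton.elim g 1]
    simp [unitCoeff_apply, MonoidAlgebra.one_def]
  have h2 := (projProperties 1).mul Θ Θ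
  rw [if_pos rfl, h1 Θ.proj] at h2
  rw [h1 Θ.proj]
  have h3 := unitCoeff_ne_zero (e := Θ.proj)
    (by rw [IsIdempotentElem, (projProperties 1).mul, if_pos rfl]) Θ.proj_ne_zero
  have h4 := congrArg unitCoeff h2
  simp only [mul_smul_comm, map_smul, unitCoeff_one, smul_eq_mul, mul_one] at h4
  rw [mul_right_eq_self₀.1 h4 |>.resolve_right h3, one_smul]

end StandardTableau

/-! ### The action on tensor space -/

theorem permRep_tprod {N n : ℕ} (σ : Equiv.Perm (Fin n)) (v : Fin n → V N) :
    permRep N n σ (PiTensorProduct.tprod ℂ v) = PiTensorProduct.tprod ℂ fun i => v (σ⁻¹ i) :=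
  PiTensorProduct.reindex_tprod σ v

theorem stdBasis_apply {N n : ℕ} (a : Fin n → Fin N) :
    stdBasis N n a = PiTensorProduct.tprod ℂ fun i => EuclideanSpace.basisFun (Fin N) ℂ (a i) := by
  simp [stdBasis]

theorem permRep_stdBasis {N n : ℕ} (σ : Equiv.Perm (Fin n)) (a : Fin n → Fin N) :
    permRep N n σ (stdBasis N n a) = stdBasis N n (a ∘ ⇑σ⁻¹) := by
  rw [stdBasis_apply, permRep_tprod, stdBasis_apply]
  rfl

theorem stdBasis_repr_permRep {N n : ℕ} (σ : Equiv.Perm (Fin n)) (x : VPow N n)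
    (a : Fin n → Fin N) :
    (stdBasis N n).repr (permRep N n σ x) a = (stdBasis N n).repr x (a ∘ σ) := by
  classical
  have h : (Finsupp.lapply a ∘ₗ (stdBasis N n).repr.toLinearMap ∘ₗ permRep N n σ :
      VPow N n →ₗ[ℂ] ℂ) = Finsupp.lapply (a ∘ σ) ∘ₗ (stdBasis N n).repr.toLinearMap := by
    refine (stdBasis N n).ext fun b => ?_
    simp only [LinearMap.comp_apply, LinearEquiv.coe_coe, permRep_stdBasis, Module.Basis.repr_self,
      Finsupp.lapply_apply, Finsupp.single_apply]
    congr 1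
    rw [eq_iff_iff]
    constructor
    · rintro rfl
      ext i
      simp
    · rintro rfl
      ext i
      simp
  exact LinearMap.congr_fun h x

/-- The action of the group algebra of `S_n` on `V^{⊗ n}`. -/
abbrev algRep (N n : ℕ) :
    MonoidAlgebra ℂ (Equiv.Perm (Fin n)) →ₐ[ℂ] Module.End ℂ (VPow N n) :=
  (permRep N n).asAlgebraHom

theorem tensorOne_permRep {N n : ℕ} (σ : Equiv.Perm (Fin n)) :
    tensorOne (permRep N n σ) = permRep N (n + 1) (extendPerm n σ) := by
  have h : (TensorPower.mulEquiv (R := ℂ) (M := V N) (n := n) (m := 1)).toLinearMap ∘ₗ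
      TensorProduct.map (permRep N n σ) LinearMap.id =
      permRep N (n + 1) (extendPerm n σ) ∘ₗ
        (TensorPower.mulEquiv (R := ℂ) (M := V N) (n := n) (m := 1)).toLinearMap := by
    refine TensorProduct.ext (PiTensorProduct.ext (MultilinearMap.ext fun v =>
      PiTensorProduct.ext (MultilinearMap.ext fun w => ?_)))
    have hm : ∀ v : Fin n → V N, TensorPower.mulEquiv (R := ℂ) (M := V N) (n := n) (m := 1)
        (PiTensorProduct.tprod ℂ v ⊗ₜ PiTensorProduct.tprod ℂ w) =
        PiTensorProduct.tprod ℂ (Fin.append v w) := fun v => TensorPower.tprod_mul_tprod ℂ v w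
    change TensorPower.mulEquiv (R := ℂ) (M := V N) (n := n) (m := 1)
      (permRep N n σ (PiTensorProduct.tprod ℂ v) ⊗ₜ PiTensorProduct.tprod ℂ w) =
      permRep N (n + 1) (extendPerm n σ) (TensorPower.mulEquiv (R := ℂ) (M := V N) (n := n) (m := 1)
        (PiTensorProduct.tprod ℂ v ⊗ₜ PiTensorProduct.tprod ℂ w))
    rw [permRep_tprod, hm, hm, permRep_tprod, ← map_inv]
    congr 1
    funext i
    induction i using Fin.lastCases with
    | last =>
      rw [extendPerm_last]
      exact (Fin.append_right (fun i => v (σ⁻¹ i)) w 0).trans (Fin.append_right v w 0).symm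
    | cast i =>
      rw [extendPerm_castSucc]
      exact (Fin.append_left (fun i => v (σ⁻¹ i)) w i).trans (Fin.append_left v w (σ⁻¹ i)).symm
  refine LinearMap.ext fun z => ?_
  obtain ⟨y, rfl⟩ := (TensorPower.mulEquiv (R := ℂ) (M := V N) (n := n) (m := 1)).surjective z
  have := LinearMap.congr_fun h y
  simpa [tensorOne, LinearEquiv.conj_apply] using this

theorem tensorOne_algRep {N n : ℕ} (x : MonoidAlgebra ℂ (Equiv.Perm (Fin n))) :
    tensorOne (algRep N n x) = algRep N (n + 1) (extendAlg n x) := by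
  have hadd : ∀ A B : Module.End ℂ (VPow N n), tensorOne (A + B) = tensorOne A + tensorOne B := by
    intro A B
    simp [tensorOne, TensorProduct.map_add_left]
  have hsmul : ∀ (c : ℂ) (A : Module.End ℂ (VPow N n)), tensorOne (c • A) = c • tensorOne A := by
    intro c A
    simp [tensorOne, TensorProduct.map_smul_left]
  induction x using MonoidAlgebra.induction_linear with
  | zero => simpa using hsmul 0 0
  | add x y hx hy => rw [map_add, hadd, hx, hy, map_add, map_add]
  | single σ c =>
    rw [extendAlg_single, Representation.asAlgebraHom_single, hsmul, tensorOne_permRep,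
      Representation.asAlgebraHom_single]

/-- The recursion for `proj` starts at the empty tableau, that for `P` only at three boxes; they
agree because the projector of a parent with at most one box is `1`. -/
theorem P_eq_algRep_proj (N : ℕ) {n : ℕ} (Θ : StandardTableau n) : P N Θ = algRep N n Θ.proj := by
  induction n with
  | zero =>
    rw [P, Y]
    congr 1
    rw [StandardTableau.proj, StandardTableau.young, Θ.hookProduct_zero,
      StandardTableau.rowSymmetrizer, StandardTableau.colAntisymmetrizer,
      Finset.sum_eq_single_of_mem 1 Θ.one_mem_rowPerms
        fun σ _ h => absurd (Subsingleton.elim σ 1) h,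
      Finset.sum_eq_single_of_mem 1 Θ.one_mem_colPerms
        fun σ _ h => absurd (Subsingleton.elim σ 1) h]
    simp [MonoidAlgebra.one_def, single_mul_single]
  | succ n ih =>
    rw [StandardTableau.proj, map_mul, map_mul]
    match n, ih, Θ with
    | 0, _, Θ => simp [P, Y, StandardTableau.proj]
    | 1, _, Θ => simp [P, Y, StandardTableau.proj_one]
    | n + 2, ih, Θ => rw [P, ih, tensorOne_algRep, Y]

theorem tensorInner_permRep {N n : ℕ} (σ : Equiv.Perm (Fin n)) (x y : VPow N n) :
    tensorInner (permRep N n σ x) y = tensorInner x (permRep N n σ⁻¹ y) := by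
  simp only [tensorInner, stdBasis_repr_permRep]
  refine Fintype.sum_equiv (Equiv.arrowCongr σ.symm (Equiv.refl (Fin N))) _ _ fun a => ?_
  simp only [Equiv.arrowCongr, Equiv.coe_fn_mk, Equiv.coe_refl, Function.id_comp, Equiv.symm_symm]
  congr 2
  ext i
  simp

theorem tensorInner_add_left {N n : ℕ} (x x' y : VPow N n) :
    tensorInner (x + x') y = tensorInner x y + tensorInner x' y := by
  simp [tensorInner, add_mul, Finset.sum_add_distrib]

theorem tensorInner_add_right {N n : ℕ} (x y y' : VPow N n) :
    tensorInner x (y + y') = tensorInner x y + tensorInner x y' := by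
  simp [tensorInner, mul_add, Finset.sum_add_distrib]

theorem tensorInner_smul_left {N n : ℕ} (c : ℂ) (x y : VPow N n) :
    tensorInner (c • x) y = starRingEnd ℂ c * tensorInner x y := by
  simp [tensorInner, Finset.mul_sum, mul_assoc]

theorem tensorInner_smul_right {N n : ℕ} (c : ℂ) (x y : VPow N n) :
    tensorInner x (c • y) = c * tensorInner x y := by
  simp only [tensorInner, Finset.mul_sum, map_smul, Finsupp.smul_apply, smul_eq_mul]
  exact Finset.sum_congr rfl fun a _ => by ring

theorem tensorInner_algRep {N n : ℕ} (z : MonoidAlgebra ℂ (Equiv.Perm (Fin n)))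
    (x y : VPow N n) :
    tensorInner (algRep N n z x) y = tensorInner x (algRep N n (adj z) y) := by
  induction z using MonoidAlgebra.induction_linear with
  | zero => simp [tensorInner]
  | add z w hz hw =>
    rw [map_add, map_add, map_add, LinearMap.add_apply, LinearMap.add_apply, tensorInner_add_left,
      tensorInner_add_right, hz, hw]
  | single σ c =>
    rw [adj_single, Representation.asAlgebraHom_single, Representation.asAlgebraHom_single,
      LinearMap.smul_apply, LinearMap.smul_apply, tensorInner_smul_left, tensorInner_smul_right,
      tensorInner_permRep]

theorem isHermitianOp_P (N : ℕ) {n : ℕ} (Θ : StandardTableau n) : IsHermitianOp (P N Θ) := by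
  intro x y
  rw [P_eq_algRep_proj, tensorInner_algRep, (StandardTableau.projProperties n).adj_proj]

theorem P_mul_P (N : ℕ) {n : ℕ} (Θ Φ : StandardTableau n) :
    P N Θ * P N Φ = if Θ = Φ then P N Θ else 0 := by
  rw [P_eq_algRep_proj, P_eq_algRep_proj, ← map_mul, (StandardTableau.projProperties n).mul]
  split_ifs <;> simp

theorem sum_P (N n : ℕ) : ∑ Θ : StandardTableau n, P N Θ = 1 := by
  rw [Finset.sum_congr rfl fun Θ _ => P_eq_algRep_proj N Θ, ← map_sum,
    (StandardTableau.projProperties n).sum, map_one]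

/-- By cyclicity `tr (q Y q) = tr (q Y) = tr (q Y Y) = tr (Y q Y) = tr Y`. -/
theorem trace_P (N : ℕ) {n : ℕ} (Θ : StandardTableau (n + 1)) :
    LinearMap.trace ℂ (VPow N (n + 1)) (P N Θ) = LinearMap.trace ℂ (VPow N (n + 1)) (Y N Θ) := by
  have hq := ((StandardTableau.projProperties n).isIdempotentElem_parentProj Θ).eq
  rw [P_eq_algRep_proj, Y, StandardTableau.proj_succ, map_mul, LinearMap.trace_mul_comm,
    ← map_mul, ← mul_assoc, hq]
  conv_lhs => rw [← Θ.young_mul_young, ← mul_assoc, map_mul, LinearMap.trace_mul_comm, ← map_mul,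
    ← mul_assoc, Θ.young_mul_parentProj_mul_young]

/-! ### Invariance, and vanishing according to the number of rows -/

/-- The operator `f ⊗ ⋯ ⊗ f` on `V^{⊗ n}` given by a matrix. -/
def tensorPow {N : ℕ} (n : ℕ) (X : Matrix (Fin N) (Fin N) ℂ) : Module.End ℂ (VPow N n) :=
  PiTensorProduct.map fun _ : Fin n => Matrix.toEuclideanLin X

theorem permRep_comm_tensorPow {N n : ℕ} (σ : Equiv.Perm (Fin n)) (X : Matrix (Fin N) (Fin N) ℂ) :
    Commute (permRep N n σ) (tensorPow n X) := by
  refine PiTensorProduct.ext (MultilinearMap.ext fun v => ?_)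
  change permRep N n σ (tensorPow n X (PiTensorProduct.tprod ℂ v)) =
    tensorPow n X (permRep N n σ (PiTensorProduct.tprod ℂ v))
  rw [permRep_tprod, tensorPow, PiTensorProduct.map_tprod, PiTensorProduct.map_tprod,
    permRep_tprod]

theorem algRep_comm {N n : ℕ} {T : Module.End ℂ (VPow N n)}
    (hT : ∀ σ, Commute (permRep N n σ) T) (z : MonoidAlgebra ℂ (Equiv.Perm (Fin n))) :
    Commute (algRep N n z) T := by
  induction z using MonoidAlgebra.induction_linear with
  | zero => simp
  | add z w hz hw => rw [map_add]; exact hz.add_left hw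
  | single σ c => rw [Representation.asAlgebraHom_single]; exact (hT σ).smul_left c

/-- The range of `P_Θ` as a subrepresentation of `SU(N)`. -/
def projRange (N : ℕ) {n : ℕ} (Θ : StandardTableau n) : Subrepresentation (suRep N n) where
  toSubmodule := LinearMap.range (P N Θ)
  apply_mem_toSubmodule g v hv := by
    obtain ⟨w, rfl⟩ := hv
    refine ⟨suRep N n g w, ?_⟩
    rw [P_eq_algRep_proj]
    exact LinearMap.congr_fun (algRep_comm (fun σ => permRep_comm_tensorPow σ g.1) Θ.proj).eq w

theorem isOrthogonalProjectorOnto_P (N : ℕ) {n : ℕ} (Θ : StandardTableau n) :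
    IsOrthogonalProjectorOnto (P N Θ) (LinearMap.range (P N Θ)) := by
  intro x
  refine ⟨⟨x, rfl⟩, ?_⟩
  rintro _ ⟨y, rfl⟩
  have h := P_mul_P N Θ Θ
  rw [if_pos rfl] at h
  rw [isHermitianOp_P, map_sub, ← Module.End.mul_apply, h, sub_self]
  simp [tensorInner]

/-- By the pigeonhole principle a basis tensor repeats a vector at two entries of the first column.
Their transposition fixes the tensor, while the antisymmetrizer changes sign. -/
theorem algRep_colAntisymmetrizer_eq_zero {N n : ℕ} (Θ : StandardTableau n) (h : N < Θ.numRows) :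
    algRep N n Θ.colAntisymmetrizer = 0 := by
  refine (stdBasis N n).ext fun a => ?_
  have hmem : ∀ k : Fin Θ.numRows, ∃ i, Θ.pos i = ((k : ℕ), 0) := fun k => by
    rw [← Θ.mem_shape_iff, YoungDiagram.mem_iff_lt_colLen]
    exact k.2
  choose e he using hmem
  obtain ⟨k, l, hkl, hakl⟩ := Fintype.exists_ne_map_eq_of_card_lt (fun k => a (e k)) (by simpa)
  have hij : e k ≠ e l := by
    intro hh
    have := congrArg Θ.pos hh
    rw [he, he, Prod.mk.injEq] at this
    exact hkl (Fin.ext this.1)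
  have hcol : Equiv.swap (e k) (e l) ∈ Θ.colPerms := by
    rw [StandardTableau.mem_colPerms]
    intro j
    by_cases hi : j = e k
    · rw [hi, Equiv.swap_apply_left, he, he]
    by_cases hj : j = e l
    · rw [hj, Equiv.swap_apply_right, he, he]
    rw [Equiv.swap_apply_of_ne_of_ne hi hj]
  have hfix : permRep N n (Equiv.swap (e k) (e l)) (stdBasis N n a) = stdBasis N n a := by
    rw [permRep_stdBasis]
    congr 1
    funext j
    simp only [Function.comp_apply, Equiv.swap_inv]
    by_cases hi : j = e k
    · rw [hi, Equiv.swap_apply_left]; exact hakl.symm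
    by_cases hj : j = e l
    · rw [hj, Equiv.swap_apply_right]; exact hakl
    rw [Equiv.swap_apply_of_ne_of_ne hi hj]
  have h1 := congrArg (fun z => algRep N n z (stdBasis N n a))
    (Θ.colAntisymmetrizer_mul_single hcol)
  simp only [map_mul, Representation.asAlgebraHom_single_one, Module.End.mul_apply, hfix, map_smul,
    LinearMap.smul_apply, Equiv.Perm.sign_swap hij] at h1
  rw [LinearMap.zero_apply]
  have h2 : (2 : ℂ) • algRep N n Θ.colAntisymmetrizer (stdBasis N n a) = 0 := by
    rw [two_smul]
    nth_rewrite 1 [h1]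
    simp
  exact (smul_eq_zero.1 h2).resolve_left two_ne_zero

theorem P_eq_zero {N n : ℕ} (Θ : StandardTableau (n + 1)) (h : N < Θ.numRows) : P N Θ = 0 := by
  rw [P_eq_algRep_proj, StandardTableau.proj_succ, StandardTableau.young, map_mul, map_mul,
    map_smul, map_mul, algRep_colAntisymmetrizer_eq_zero Θ h]
  simp

theorem Y_ne_zero {N n : ℕ} (Θ : StandardTableau n) (h : Θ.numRows ≤ N) : Y N Θ ≠ 0 := by
  classical
  have hrow : ∀ i, (Θ.pos i).1 < N := fun i => by
    have h1 : ((Θ.pos i).1, (Θ.pos i).2) ∈ Θ.shape := (Θ.mem_shape_iff _).2 ⟨i, rfl⟩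
    have h2 := Θ.shape.up_left_mem le_rfl (Nat.zero_le _) h1
    rw [YoungDiagram.mem_iff_lt_colLen] at h2
    exact h2.trans_le h
  -- Every factor is labelled by the row of its entry, so the stabilizer of the basis tensor is
  -- exactly the horizontal group. Antisymmetrizing then leaves coefficient `1` at `b`, and
  -- symmetrizing multiplies it by the number of horizontal permutations.
  let b : Fin n → Fin N := fun i => ⟨(Θ.pos i).1, hrow i⟩
  have hb : ∀ σ : Equiv.Perm (Fin n), b ∘ σ = b ↔ σ ∈ Θ.rowPerms := by
    intro σ
    rw [StandardTableau.mem_rowPerms, funext_iff]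
    simp [b, Fin.ext_iff]
  have h1 : (stdBasis N n).repr (algRep N n Θ.colAntisymmetrizer (stdBasis N n b)) b = 1 := by
    rw [StandardTableau.colAntisymmetrizer, map_sum, LinearMap.sum_apply, map_sum,
      Finsupp.finsetSum_apply, Finset.sum_eq_single_of_mem 1 Θ.one_mem_colPerms]
    · simp
    · intro σ hσ hne
      rw [Representation.asAlgebraHom_single, LinearMap.smul_apply, map_smul, Finsupp.smul_apply,
        stdBasis_repr_permRep, Module.Basis.repr_self, Finsupp.single_apply, if_neg, smul_zero]
      intro hh
      exact hne (Θ.eq_one_of_mem_rowPerms_of_mem_colPerms ((hb σ).1 hh.symm) hσ)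
  intro h0
  have h2 := congrArg (fun A : Module.End ℂ (VPow N n) =>
    (stdBasis N n).repr (A (stdBasis N n b)) b) h0
  simp only [Y, StandardTableau.young, map_smul, map_mul, LinearMap.smul_apply,
    Module.End.mul_apply, Finsupp.smul_apply, LinearMap.zero_apply, map_zero,
    Finsupp.zero_apply, smul_eq_zero, inv_eq_zero, Nat.cast_eq_zero] at h2
  have h3 := h2.resolve_left Θ.hookProduct_pos.ne'
  rw [StandardTableau.rowSymmetrizer, map_sum, LinearMap.sum_apply, map_sum,
    Finsupp.finsetSum_apply, Finset.sum_congr rfl fun σ hσ => by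
      rw [Representation.asAlgebraHom_single_one, stdBasis_repr_permRep, (hb σ).2 hσ, h1],
    Finset.sum_const, nsmul_eq_mul, mul_one, Nat.cast_eq_zero] at h3
  exact Finset.card_ne_zero_of_mem Θ.one_mem_rowPerms h3

theorem finite_VPow (N n : ℕ) : Module.Finite ℂ (VPow N n) := Module.Finite.of_basis (stdBasis N n)

/-- The trace of `P` is that of the nonzero idempotent `Y`, hence not zero. -/
theorem P_ne_zero {N n : ℕ} (Θ : StandardTableau (n + 1)) (h : Θ.numRows ≤ N) : P N Θ ≠ 0 := by
  have := finite_VPow N (n + 1)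
  intro h0
  have h1 := trace_P N Θ
  rw [h0, map_zero, eq_comm] at h1
  refine Y_ne_zero Θ h (LinearMap.IsIdempotentElem.eq_zero_of_trace_eq_zero ?_ h1)
  rw [IsIdempotentElem, Y, ← map_mul, Θ.young_mul_young]

/-! ### Matrix elements of tensor powers -/

theorem toEuclideanLin_mul {N : ℕ} (X Z : Matrix (Fin N) (Fin N) ℂ) :
    Matrix.toEuclideanLin (X * Z) = Matrix.toEuclideanLin X ∘ₗ Matrix.toEuclideanLin Z := by
  ext v : 1
  simp [Matrix.toLpLin_apply]

theorem tensorPow_mul {N : ℕ} (n : ℕ) (X Z : Matrix (Fin N) (Fin N) ℂ) :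
    tensorPow n (X * Z) = tensorPow n X * tensorPow n Z := by
  refine PiTensorProduct.ext (MultilinearMap.ext fun v => ?_)
  change tensorPow n (X * Z) (PiTensorProduct.tprod ℂ v) =
    tensorPow n X (tensorPow n Z (PiTensorProduct.tprod ℂ v))
  simp only [tensorPow, PiTensorProduct.map_tprod, toEuclideanLin_mul, LinearMap.comp_apply]

theorem tensorPow_smul {N : ℕ} (n : ℕ) (c : ℂ) (X : Matrix (Fin N) (Fin N) ℂ) :
    tensorPow n (c • X) = c ^ n • tensorPow n X := by
  refine PiTensorProduct.ext (MultilinearMap.ext fun v => ?_)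
  change tensorPow n (c • X) (PiTensorProduct.tprod ℂ v) =
    c ^ n • tensorPow n X (PiTensorProduct.tprod ℂ v)
  simp only [tensorPow, PiTensorProduct.map_tprod, map_smul, LinearMap.smul_apply]
  rw [MultilinearMap.map_smul_univ]
  simp

theorem tensorPow_stdBasis_repr {N n : ℕ} (X : Matrix (Fin N) (Fin N) ℂ) (a b : Fin n → Fin N) :
    (stdBasis N n).repr (tensorPow n X (stdBasis N n b)) a = ∏ i, X (a i) (b i) := by
  rw [stdBasis_apply, tensorPow, PiTensorProduct.map_tprod, stdBasis,
    Basis.piTensorProduct_repr_tprod_apply]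
  refine Finset.prod_congr rfl fun i _ => ?_
  simp [Matrix.toLpLin_apply]

/-- A functional applied to the image of a vector, expanded in the basis. -/
theorem dual_apply_eq_sum {N n : ℕ} (ℓ : Module.Dual ℂ (VPow N n)) (T : Module.End ℂ (VPow N n))
    (w : VPow N n) :
    ℓ (T w) = ∑ p : (Fin n → Fin N) × (Fin n → Fin N),
      (stdBasis N n).repr (T (stdBasis N n p.2)) p.1 *
        ((stdBasis N n).repr w p.2 * ℓ (stdBasis N n p.1)) := by
  conv_lhs => rw [← (stdBasis N n).sum_repr w]
  rw [map_sum, map_sum, Fintype.sum_prod_type_right]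
  refine Finset.sum_congr rfl fun b _ => ?_
  rw [map_smul, map_smul, smul_eq_mul]
  conv_lhs => rw [← (stdBasis N n).sum_repr (T (stdBasis N n b))]
  rw [map_sum, Finset.mul_sum]
  refine Finset.sum_congr rfl fun a _ => ?_
  rw [map_smul, smul_eq_mul]
  ring

/-- Turns stability of a subspace into the vanishing of functions that are polynomial in the matrix
entries. -/
theorem mem_of_forall_dual {E : Type*} [AddCommGroup E] [Module ℂ E] {W : Submodule ℂ E} {x : E}
    (h : ∀ ℓ : Module.Dual ℂ E, W ≤ LinearMap.ker ℓ → ℓ x = 0) : x ∈ W := by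
  by_contra hx
  obtain ⟨f, hf, hW⟩ := Submodule.exists_le_ker_of_notMem hx
  exact hf (h f hW)

/-- The submodule `W` is mapped to itself by `T`. -/
def Stable {E : Type*} [AddCommGroup E] [Module ℂ E] (W : Submodule ℂ E) (T : Module.End ℂ E) :
    Prop := ∀ w ∈ W, T w ∈ W

theorem infinite_unit_circle : {z : ℂ | ‖z‖ = 1}.Infinite := by
  have h : {z : ℂ | ‖z‖ = 1} = Metric.sphere 0 1 := by ext z; simp
  rw [h]
  have hrank : 1 < Module.rank ℝ ℂ := by rw [Complex.rank_real_complex]; norm_num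
  refine (isPreconnected_sphere hrank 0 1).infinite_of_nontrivial ⟨1, by simp, -1, by simp, ?_⟩
  norm_num

/-! ### From `SU(N)` to the commutant of the permutations -/

section Density

variable {N n : ℕ} {W : Submodule ℂ (VPow N n)}

theorem stable_unitary (hN : N ≠ 0)
    (hW : ∀ g : Matrix.specialUnitaryGroup (Fin N) ℂ, Stable W (tensorPow n g.1))
    {U : Matrix (Fin N) (Fin N) ℂ} (hU : U ∈ Matrix.unitaryGroup (Fin N) ℂ) :
    Stable W (tensorPow n U) := by
  have hdet : star U.det * U.det = 1 :=
    Unitary.star_mul_self_of_mem (Matrix.det_of_mem_unitary hU)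
  -- Dividing `U` by an `N`-th root `c` of its determinant, which has modulus one, gives a special
  -- unitary matrix; the tensor powers differ by the scalar `c ^ n`.
  obtain ⟨c, hc⟩ := IsAlgClosed.exists_pow_nat_eq U.det (Nat.pos_of_ne_zero hN)
  have hnd : ‖U.det‖ = 1 := by
    have := congrArg norm hdet
    rw [norm_mul, norm_star, norm_one] at this
    nlinarith [norm_nonneg U.det]
  have hnc : ‖c‖ = 1 := by
    rw [← hc, norm_pow] at hnd
    exact (pow_eq_one_iff_of_nonneg (norm_nonneg c) hN).1 hnd
  have hc0 : c ≠ 0 := by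
    rintro rfl
    simp at hnc
  have hcc : star c⁻¹ * c⁻¹ = 1 := by
    rw [Complex.star_def, ← Complex.normSq_eq_conj_mul_self, Complex.normSq_eq_norm_sq, norm_inv,
      hnc]
    simp
  have hmem : c⁻¹ • U ∈ Matrix.specialUnitaryGroup (Fin N) ℂ := by
    rw [Matrix.mem_specialUnitaryGroup_iff, Matrix.mem_unitaryGroup_iff', Matrix.det_smul,
      Fintype.card_fin, inv_pow, hc]
    constructor
    · rw [star_smul, Matrix.smul_mul, Matrix.mul_smul, smul_smul, hcc, one_smul,
        Matrix.mem_unitaryGroup_iff'.1 hU]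
    · refine inv_mul_cancel₀ fun h0 => ?_
      rw [h0, norm_zero] at hnd
      exact zero_ne_one hnd
  intro w hw
  have h1 := hW ⟨_, hmem⟩ w hw
  have h2 : tensorPow n U w = c ^ n • tensorPow n (c⁻¹ • U) w := by
    rw [← LinearMap.smul_apply, ← tensorPow_smul, smul_smul, mul_inv_cancel₀ hc0, one_smul]
  rw [h2]
  exact W.smul_mem _ h1

/-- A functional that kills `W` gives a polynomial in the diagonal entries. It vanishes on the torus
of unimodular entries, a product of infinite sets, hence identically. -/
theorem stable_diagonal
    (hW : ∀ U ∈ Matrix.unitaryGroup (Fin N) ℂ, Stable W (tensorPow n U)) (d : Fin N → ℂ) :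
    Stable W (tensorPow n (Matrix.diagonal d)) := by
  intro w hw
  refine mem_of_forall_dual fun ℓ hℓ => ?_
  let Q : MvPolynomial (Fin N) ℂ := ∑ p : (Fin n → Fin N) × (Fin n → Fin N),
    (∏ i, if p.1 i = p.2 i then MvPolynomial.X (p.1 i) else 0) *
      MvPolynomial.C ((stdBasis N n).repr w p.2 * ℓ (stdBasis N n p.1))
  have hQ : ∀ t : Fin N → ℂ, ℓ (tensorPow n (Matrix.diagonal t) w) = MvPolynomial.eval t Q := by
    intro t
    rw [dual_apply_eq_sum]
    simp only [Q, map_sum, map_mul, map_prod, MvPolynomial.eval_C, tensorPow_stdBasis_repr,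
      Matrix.diagonal_apply, apply_ite (MvPolynomial.eval t), MvPolynomial.eval_X, map_zero]
  have hQ0 : Q = 0 := by
    refine MvPolynomial.funext_set (fun _ => {z : ℂ | ‖z‖ = 1}) (fun _ => infinite_unit_circle)
      fun t ht => ?_
    rw [map_zero, ← hQ]
    refine hℓ (hW _ ?_ w hw)
    rw [Matrix.mem_unitaryGroup_iff', Matrix.star_eq_conjTranspose, Matrix.diagonal_conjTranspose,
      Matrix.diagonal_mul_diagonal, ← Matrix.diagonal_one]
    congr 1
    funext i
    have : ‖t i‖ = 1 := ht i (Set.mem_univ i)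
    rw [Pi.star_apply, Complex.star_def, ← Complex.normSq_eq_conj_mul_self,
      Complex.normSq_eq_norm_sq, this]
    simp
  rw [hQ, hQ0, map_zero]

open scoped ComplexOrder in
/-- A singular value decomposition of an invertible matrix. -/
theorem exists_unitary_diagonal_unitary {X : Matrix (Fin N) (Fin N) ℂ} (hX : X.det ≠ 0) :
    ∃ U ∈ Matrix.unitaryGroup (Fin N) ℂ, ∃ d : Fin N → ℂ, ∃ Q ∈ Matrix.unitaryGroup (Fin N) ℂ,
      X = U * Matrix.diagonal d * Q := by
  have hinj : Function.Injective X.mulVec :=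
    Matrix.mulVec_injective_of_isUnit ((Matrix.isUnit_iff_isUnit_det X).2 (IsUnit.mk0 _ hX))
  have hpos : (X.conjTranspose * X).PosDef := Matrix.PosDef.conjTranspose_mul_self X hinj
  set E := hpos.1.eigenvectorUnitary
  set lam := hpos.1.eigenvalues with hlam
  have hlampos : ∀ i, 0 < lam i := hpos.eigenvalues_pos
  have hspec : X.conjTranspose * X =
      (E : Matrix (Fin N) (Fin N) ℂ) * Matrix.diagonal (fun i => (lam i : ℂ)) *
        star (E : Matrix (Fin N) (Fin N) ℂ) := by
    have := hpos.1.spectral_theorem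
    rw [Unitary.conjStarAlgAut_apply] at this
    exact this
  have hE : star (E : Matrix (Fin N) (Fin N) ℂ) * E = 1 := Unitary.coe_star_mul_self E
  have hE' : (E : Matrix (Fin N) (Fin N) ℂ) * star (E : Matrix (Fin N) (Fin N) ℂ) = 1 :=
    Unitary.coe_mul_star_self E
  let d : Fin N → ℂ := fun i => ((Real.sqrt (lam i) : ℝ) : ℂ)
  have hd0 : ∀ i, d i ≠ 0 := fun i => by
    simp only [d, ne_eq, Complex.ofReal_eq_zero]
    exact (Real.sqrt_pos.2 (hlampos i)).ne'
  have hdd : ∀ i, d i * d i = lam i := fun i => by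
    simp only [d]
    rw [← Complex.ofReal_mul, Real.mul_self_sqrt (hlampos i).le]
  have hstar : ∀ i, star (d i) = d i := fun i => by simp [d]
  -- `E` diagonalizes `X† X` with eigenvalues `d²`; dividing the columns of `X E` by the singular
  -- values `d` makes them orthonormal.
  refine ⟨X * E * Matrix.diagonal fun i => (d i)⁻¹, ?_, d, star (E : Matrix (Fin N) (Fin N) ℂ),
    Unitary.star_mem E.2, ?_⟩
  · rw [Matrix.mem_unitaryGroup_iff', star_mul, star_mul, Matrix.star_eq_conjTranspose X,
      Matrix.star_eq_conjTranspose (Matrix.diagonal _), Matrix.diagonal_conjTranspose]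
    calc Matrix.diagonal (star fun i => (d i)⁻¹) *
          (star (E : Matrix (Fin N) (Fin N) ℂ) * X.conjTranspose) *
          (X * E * Matrix.diagonal fun i => (d i)⁻¹)
        = Matrix.diagonal (star fun i => (d i)⁻¹) * (star (E : Matrix (Fin N) (Fin N) ℂ) *
          (X.conjTranspose * X) * E) * Matrix.diagonal fun i => (d i)⁻¹ := by
          simp only [Matrix.mul_assoc]
      _ = Matrix.diagonal (star fun i => (d i)⁻¹) * ((star (E : Matrix (Fin N) (Fin N) ℂ) * E) *
          Matrix.diagonal (fun i => (lam i : ℂ)) * (star (E : Matrix (Fin N) (Fin N) ℂ) * E)) *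
            Matrix.diagonal fun i => (d i)⁻¹ := by
          rw [hspec]
          simp only [Matrix.mul_assoc]
      _ = 1 := by
          rw [hE, Matrix.one_mul, Matrix.mul_one, Matrix.diagonal_mul_diagonal,
            Matrix.diagonal_mul_diagonal, ← Matrix.diagonal_one]
          congr 1
          funext i
          rw [Pi.star_apply, star_inv₀, hstar, ← hdd]
          have := hd0 i
          field_simp
  · rw [Matrix.mul_assoc (X * (E : Matrix (Fin N) (Fin N) ℂ)), Matrix.diagonal_mul_diagonal]
    have : (fun i => (d i)⁻¹ * d i) = fun _ => (1 : ℂ) := funext fun i => inv_mul_cancel₀ (hd0 i)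
    rw [this, Matrix.diagonal_one, Matrix.mul_one, Matrix.mul_assoc, hE', Matrix.mul_one]

theorem stable_of_det_ne_zero
    (hW : ∀ U ∈ Matrix.unitaryGroup (Fin N) ℂ, Stable W (tensorPow n U))
    {X : Matrix (Fin N) (Fin N) ℂ} (hX : X.det ≠ 0) : Stable W (tensorPow n X) := by
  obtain ⟨U, hU, d, Q, hQ, rfl⟩ := exists_unitary_diagonal_unitary hX
  intro w hw
  rw [tensorPow_mul, tensorPow_mul]
  exact hW U hU _ (stable_diagonal hW d _ (hW Q hQ w hw))

/-- Equal multiplicities make all fibres of `f` and `g` equinumerous; bijections of the fibres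
assemble to a permutation. -/
theorem exists_perm_of_sum_single_eq {κ : Type*} {f g : Fin n → κ}
    (h : ∑ i, Finsupp.single (f i) 1 = ∑ i, Finsupp.single (g i) (1 : ℕ)) :
    ∃ σ : Equiv.Perm (Fin n), f = g ∘ σ := by
  classical
  have hcard : ∀ k, Fintype.card {i // f i = k} = Fintype.card {i // g i = k} := by
    intro k
    have := DFunLike.congr_fun h k
    simpa [Finsupp.finsetSum_apply, Finsupp.single_apply, Fintype.card_subtype] using this
  exact ⟨Equiv.ofFiberEquiv fun k => Fintype.equivOfCardEq (hcard k),
    funext fun i => (Equiv.ofFiberEquiv_map _ i).symm⟩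

/-- A subspace that is stable under all invertible tensor powers is stable under all operators that
commute with the permutations. -/
theorem stable_of_commute
    (hW : ∀ X : Matrix (Fin N) (Fin N) ℂ, X.det ≠ 0 → Stable W (tensorPow n X))
    {T : Module.End ℂ (VPow N n)} (hT : ∀ σ, Commute (permRep N n σ) T) : Stable W T := by
  classical
  intro w hw
  refine mem_of_forall_dual fun ℓ hℓ => ?_
  let κ := (Fin n → Fin N) × (Fin n → Fin N)
  let c : κ → ℂ := fun p => (stdBasis N n).repr w p.2 * ℓ (stdBasis N n p.1)
  -- The matrix element of `X ⊗ ⋯ ⊗ X` at the index pair `p` is the monomial with exponent `e p` in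
  -- the entries of `X`.
  let e : κ → (Fin N × Fin N →₀ ℕ) := fun p => ∑ i, Finsupp.single (p.1 i, p.2 i) 1
  let m : κ → ℂ := fun p => (stdBasis N n).repr (T (stdBasis N n p.2)) p.1
  let Q : MvPolynomial (Fin N × Fin N) ℂ := ∑ p : κ, MvPolynomial.monomial (e p) (c p)
  have hQ : ∀ X : Matrix (Fin N) (Fin N) ℂ,
      ℓ (tensorPow n X w) = MvPolynomial.eval (fun q => X q.1 q.2) Q := by
    intro X
    rw [dual_apply_eq_sum, map_sum]
    refine Finset.sum_congr rfl fun p _ => ?_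
    have : MvPolynomial.monomial (e p) (c p) =
        MvPolynomial.C (c p) * ∏ i, MvPolynomial.X (p.1 i, p.2 i) := by
      exact MvPolynomial.monomial_sum_index Finset.univ _ (c p)
    rw [this, tensorPow_stdBasis_repr, map_mul, MvPolynomial.eval_C, map_prod, mul_comm]
    simp [c]
  have hQ0 : Q = 0 := by
    -- `Q` vanishes where the determinant does not, so the product vanishes everywhere; the generic
    -- determinant is a nonzero polynomial and cancels.
    have h1 : Q * (Matrix.mvPolynomialX (Fin N) (Fin N) ℂ).det = 0 := by
      refine MvPolynomial.funext fun t => ?_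
      rw [map_mul, map_zero]
      let X : Matrix (Fin N) (Fin N) ℂ := Matrix.of fun i j => t (i, j)
      have hX : MvPolynomial.eval t (Matrix.mvPolynomialX (Fin N) (Fin N) ℂ).det = X.det := by
        rw [RingHom.map_det]
        exact congrArg Matrix.det (Matrix.mvPolynomialX_mapMatrix_eval X)
      rw [hX]
      by_cases h0 : X.det = 0
      · rw [h0, mul_zero]
      · have h2 : MvPolynomial.eval t Q = 0 := by
          have := hQ X
          rw [show ℓ (tensorPow n X w) = 0 from hℓ (hW X h0 w hw)] at this
          exact this.symm
        rw [h2, zero_mul]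
    exact (mul_eq_zero.1 h1).resolve_right (Matrix.det_mvPolynomialX_ne_zero (Fin N) ℂ)
  -- Pairs with the same exponent differ by a simultaneous permutation of both indices, under which
  -- the matrix elements of `T` are invariant. In `ℓ (T w)` they factor out of each fibre of `e`,
  -- and what is left is a coefficient of `Q`.
  have hm : ∀ p q : κ, e p = e q → m p = m q := by
    intro p q hpq
    obtain ⟨σ, hσ⟩ := exists_perm_of_sum_single_eq hpq
    have h1 : p.1 = q.1 ∘ σ := funext fun i => congrArg Prod.fst (congrFun hσ i)
    have h2 : p.2 = q.2 ∘ σ := funext fun i => congrArg Prod.snd (congrFun hσ i)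
    simp only [m]
    rw [h1, ← stdBasis_repr_permRep, h2]
    have h3 := LinearMap.congr_fun (hT σ).eq (stdBasis N n (q.2 ∘ σ))
    rw [Module.End.mul_apply, Module.End.mul_apply, permRep_stdBasis] at h3
    rw [h3]
    congr 4
    funext i
    simp
  have hfib : ∀ k : Fin N × Fin N →₀ ℕ, ∑ p : κ with e p = k, c p = 0 := by
    intro k
    have := congrArg (MvPolynomial.coeff k) hQ0
    rw [MvPolynomial.coeff_sum, MvPolynomial.coeff_zero] at this
    rw [Finset.sum_filter]
    refine Eq.trans ?_ this
    exact Finset.sum_congr rfl fun p _ => by rw [MvPolynomial.coeff_monomial]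
  rw [dual_apply_eq_sum]
  change ∑ p : κ, m p * c p = 0
  rw [← Finset.sum_fiberwise_of_maps_to (s := Finset.univ) (t := Finset.univ.image e) (g := e)
    fun p _ => Finset.mem_image_of_mem e (Finset.mem_univ p)]
  refine Finset.sum_eq_zero fun k hk => ?_
  obtain ⟨q, _, rfl⟩ := Finset.mem_image.1 hk
  rw [Finset.sum_congr rfl fun p hp => by rw [hm p q (Finset.mem_filter.1 hp).2],
    ← Finset.mul_sum, hfib, mul_zero]

end Density

/-! ### Irreducibility -/

/-- A subspace of the range of `P_Θ` that is stable under the commutant of the permutations is zero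
or the whole range. -/
theorem range_P_le_of_stable {N n : ℕ} (Θ : StandardTableau (n + 1))
    {W : Submodule ℂ (VPow N (n + 1))} (hle : W ≤ LinearMap.range (P N Θ)) (hne : W ≠ ⊥)
    (hW : ∀ T : Module.End ℂ (VPow N (n + 1)), (∀ σ, Commute (permRep N (n + 1) σ) T) →
      Stable W T) : LinearMap.range (P N Θ) ≤ W := by
  have hidem : ∀ v ∈ LinearMap.range (P N Θ), P N Θ v = v := by
    rintro _ ⟨v, rfl⟩
    rw [← Module.End.mul_apply, P_mul_P, if_pos rfl]
  obtain ⟨u, hu, hu0⟩ := Submodule.exists_mem_ne_zero_of_ne_bot hne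
  have hPu := hidem u (hle hu)
  intro w hw
  have hPw := hidem w hw
  choose c hc using fun σ : Equiv.Perm (Fin (n + 1)) => Θ.proj_mul_mul_proj (single σ 1)
  have hadj := (StandardTableau.projProperties (n + 1)).adj_proj Θ
  have hinv : ∀ σ, c σ⁻¹ = starRingEnd ℂ (c σ) := by
    intro σ
    have h1 := congrArg adj (hc σ)
    rw [adj_mul, adj_mul, adj_smul, hadj, adj_single, map_one, ← mul_assoc, hc σ⁻¹] at h1
    exact smul_left_injective ℂ Θ.proj_ne_zero h1
  have hone : c 1 = 1 := by
    have h1 := hc 1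
    rw [← MonoidAlgebra.one_def, mul_one, (StandardTableau.projProperties (n + 1)).mul,
      if_pos rfl] at h1
    refine smul_left_injective ℂ Θ.proj_ne_zero ?_
    simp only [one_smul]
    exact h1.symm
  -- Self-adjointness of `proj` makes this the sum of `|c σ|²`, to which the neutral element
  -- contributes `1`.
  have hsum : ∑ σ, c σ⁻¹ * c σ ≠ 0 := by
    have h1 : ∑ σ, c σ⁻¹ * c σ = ((∑ σ, Complex.normSq (c σ) : ℝ) : ℂ) := by
      rw [Complex.ofReal_sum]
      exact Finset.sum_congr rfl fun σ _ => by rw [hinv, Complex.normSq_eq_conj_mul_self]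
    rw [h1, Complex.ofReal_ne_zero]
    refine (Finset.sum_pos' (fun σ _ => Complex.normSq_nonneg _) ⟨1, Finset.mem_univ _, ?_⟩).ne'
    rw [hone]
    simp
  have hPP : ∀ (σ : Equiv.Perm (Fin (n + 1))) (v : VPow N (n + 1)), P N Θ v = v →
      P N Θ (permRep N (n + 1) σ v) = c σ • v := by
    intro σ v hv
    have h1 := congrArg (fun z => algRep N (n + 1) z v) (hc σ)
    simp only [map_mul, map_smul, LinearMap.smul_apply, Module.End.mul_apply,
      Representation.asAlgebraHom_single_one, ← P_eq_algRep_proj, hv] at h1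
    exact h1
  obtain ⟨φ, hφ⟩ := Module.Projective.exists_dual_eq_one ℂ hu0
  -- An operator of rank at most one taking `u` to `w`. Its average over the permutations lies in
  -- the commutant, and applying `P` shows that it takes `u` to `∑ |c σ|²` times `w`; so `w` lies in
  -- `W`.
  let T₀ : Module.End ℂ (VPow N (n + 1)) := (φ ∘ₗ P N Θ).smulRight w
  let T : Module.End ℂ (VPow N (n + 1)) :=
    ∑ σ, permRep N (n + 1) σ * T₀ * permRep N (n + 1) σ⁻¹
  have hT : ∀ τ, Commute (permRep N (n + 1) τ) T := by
    intro τ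
    rw [commute_iff_eq, Finset.mul_sum, Finset.sum_mul]
    refine Fintype.sum_equiv (Equiv.mulLeft τ) _ _ fun σ => ?_
    simp only [Equiv.coe_mulLeft, mul_inv_rev, map_mul, mul_assoc]
    rw [← map_mul (permRep N (n + 1)) τ⁻¹ τ, inv_mul_cancel, map_one, mul_one]
  have hTu : T u = ∑ σ, c σ⁻¹ • permRep N (n + 1) σ w := by
    simp only [T, LinearMap.sum_apply, Module.End.mul_apply, T₀, LinearMap.smulRight_apply,
      LinearMap.comp_apply, hPP _ u hPu, map_smul, hφ, smul_eq_mul, mul_one]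
  have hPTu : T u = (∑ σ, c σ⁻¹ * c σ) • w := by
    have h1 : T u = P N Θ (T u) := by
      have h2 := LinearMap.congr_fun (algRep_comm hT Θ.proj).eq u
      rw [← P_eq_algRep_proj, Module.End.mul_apply, Module.End.mul_apply, hPu] at h2
      exact h2.symm
    rw [h1, hTu, map_sum, Finset.sum_smul]
    exact Finset.sum_congr rfl fun σ _ => by rw [map_smul, hPP _ w hPw, smul_smul]
  have h1 := hW T hT u hu
  rw [hPTu] at h1
  exact (W.smul_mem_iff hsum).1 h1

theorem isIrreducible_projRange {N n : ℕ} (Θ : StandardTableau (n + 1)) (h : Θ.numRows ≤ N) :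
    (projRange N Θ).toRepresentation.IsIrreducible := by
  have hN : N ≠ 0 := by
    have h1 : Θ.pos 0 ∈ Θ.shape := (Θ.mem_shape_iff _).2 ⟨0, rfl⟩
    have h2 := Θ.shape.up_left_mem le_rfl (Nat.zero_le (Θ.pos 0).2) h1
    rw [YoungDiagram.mem_iff_lt_colLen] at h2
    rw [StandardTableau.numRows] at h
    omega
  have hnt : Nontrivial (Subrepresentation (projRange N Θ).toRepresentation) := by
    refine ⟨⊥, ⊤, fun he => P_ne_zero Θ h ?_⟩
    rw [← LinearMap.range_eq_bot, Submodule.eq_bot_iff]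
    intro x hx
    have h1 : (⟨x, hx⟩ : (projRange N Θ).toSubmodule) ∈
        (⊤ : Subrepresentation (projRange N Θ).toRepresentation).toSubmodule := Submodule.mem_top
    rw [← he] at h1
    exact congrArg Subtype.val ((Submodule.mem_bot ℂ).1 h1)
  refine { toNontrivial := hnt, eq_bot_or_eq_top := fun S => ?_ }
  set W : Submodule ℂ (VPow N (n + 1)) :=
    S.toSubmodule.map (projRange N Θ).toSubmodule.subtype with hWdef
  have hle : W ≤ LinearMap.range (P N Θ) := Submodule.map_subtype_le _ _
  have hSU : ∀ g : Matrix.specialUnitaryGroup (Fin N) ℂ, Stable W (tensorPow (n + 1) g.1) := by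
    rintro g _ ⟨v, hv, rfl⟩
    exact ⟨_, S.apply_mem_toSubmodule g hv, rfl⟩
  by_cases hbot : W = ⊥
  · left
    refine Subrepresentation.toSubmodule_injective ?_
    refine ((Submodule.eq_bot_iff _).2 fun v hv => ?_ : S.toSubmodule = ⊥)
    have hmem : (v : VPow N (n + 1)) ∈ W := ⟨v, hv, rfl⟩
    rw [hbot, Submodule.mem_bot] at hmem
    exact Subtype.ext hmem
  · right
    refine Subrepresentation.toSubmodule_injective ?_
    have htop := range_P_le_of_stable Θ hle hbot fun T hT =>
      stable_of_commute (fun X hX => stable_of_det_ne_zero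
        (fun U hU => stable_unitary hN hSU hU) hX) hT
    refine (Submodule.eq_top_iff'.2 fun v => ?_ : S.toSubmodule = ⊤)
    obtain ⟨v', hv', hvv⟩ := htop v.2
    rwa [← Subtype.ext hvv]

end HermitianYoung

end

theorem theorem1 (N n : ℕ) (hn : 2 ≤ n) :
    -- transversality
    (∀ Θ Φ : HermitianYoung.StandardTableau n,
      HermitianYoung.P N Θ * HermitianYoung.P N Φ =
        if Θ = Φ then HermitianYoung.P N Θ else 0) ∧
    -- dimension
    (∀ Θ : HermitianYoung.StandardTableau n,
      LinearMap.trace ℂ (HermitianYoung.VPow N n) (HermitianYoung.P N Θ) =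
        LinearMap.trace ℂ (HermitianYoung.VPow N n) (HermitianYoung.Y N Θ)) ∧
    -- completeness
    (∑ Θ : HermitianYoung.StandardTableau n, HermitianYoung.P N Θ = 1) ∧
    -- Hermiticity
    (∀ Θ : HermitianYoung.StandardTableau n,
      HermitianYoung.IsHermitianOp (HermitianYoung.P N Θ)) ∧
    -- orthogonal projectors onto invariant subspaces, which are irreducible if the tableau has
    -- at most `N` rows and zero otherwise
    (∀ Θ : HermitianYoung.StandardTableau n,
      ∃ U : Subrepresentation (HermitianYoung.suRep N n),
        LinearMap.range (HermitianYoung.P N Θ) = U.toSubmodule ∧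
        HermitianYoung.IsOrthogonalProjectorOnto (HermitianYoung.P N Θ) U.toSubmodule ∧
        (Θ.numRows ≤ N → U.toRepresentation.IsIrreducible) ∧
        (N < Θ.numRows → U = ⊥)) := by
  obtain ⟨n, rfl⟩ : ∃ k, n = k + 1 := ⟨n - 1, by omega⟩
  refine ⟨HermitianYoung.P_mul_P N, HermitianYoung.trace_P N, HermitianYoung.sum_P N (n + 1),
    HermitianYoung.isHermitianOp_P N, fun Θ => ⟨HermitianYoung.projRange N Θ, rfl,
      HermitianYoung.isOrthogonalProjectorOnto_P N Θ,
      HermitianYoung.isIrreducible_projRange Θ, fun h => ?_⟩⟩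
  refine Subrepresentation.toSubmodule_injective ?_
  change LinearMap.range (HermitianYoung.P N Θ) = ⊥
  rw [HermitianYoung.P_eq_zero Θ h, LinearMap.range_zero]
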